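/- Let $k$ be a field and let $A$ be a graded $k$-vector space, where the grading is by $\mathbb{Z}$ or by $\mathbb{Z}/N$ with $N$ even (so $\mathbb{Z}/2$-gradings are allowed). An $A_\infty$-algebra structure on $A$ consists of $k$-linear maps $m_n\colon A^{\otimes n}\to A$ of degree $2-n$, $n\ge 1$, such that for all $n\ge 1$ $$\sum_{r+s+t=n,\ s\ge 1}(-1)^{rs+t}\,m_{r+1+t}(\mathrm{id}^{\otimes r}\otimes m_s\otimes \mathrm{id}^{\otimes t})=0 ,$$ where tensor products of maps are evaluated by the Koszul sign rule. A morphism $f\colon (A,m)\to(B,m')$ consists of $k$-linear maps $f_n\colon A^{\otimes n}\to B$ of degree $1-n$, $n\ge1$, such that for all $n\ge1$ $$\sum_{i_1+\dots+i_l=n}(-1)^{\heartsuit}\,m'_l(f_{i_1}\otimes\cdots\otimes f_{i_l})=\sum_{r+s+t=n,\ s\ge 1}(-1)^{rs+t}f_{r+1+t}(\mathrm{id}^{\otimes r}\otimes m_s\otimes\mathrm{id}^{\otimes t}),\qquad \heartsuit=\sum_{j}(i_j-1)(i_1+\dots+i_{j-1}).$$ Composition is $(g\circ f)_n=\sum_{i_1+\dots+i_l=n}(-1)^{\heartsuit}g_l(f_{i_1}\otimes\cdots\otimes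 f_{i_l})$; the identity has $f_1=\mathrm{id}$ and $f_n=0$ for $n\neq 1$; an isomorphism is a morphism with a two-sided inverse; a quasi-isomorphism is a morphism for which $f_1$ induces an isomorphism on cohomology with respect to $m_1$. The algebra is minimal if $m_1=0$, and trivial if $m_n=0$ for all $n\ne2$. It is formal if it is quasi-isomorphic to a trivial $A_\infty$-algebra. Let $(A,m)$ be a minimal $A_\infty$-algebra, so that $(A,m_2)$ is a graded associative algebra. For $n\ge 0$ and $q\in\mathbb{Z}$ let $HH^{n,q}(A,m_2)$ be the cohomology, at the $k$-linear maps $\varphi\colon A^{\otimes n}\to A$ of degree $q$, of the Hochschild differential $$(d\varphi)(a_1,\dots,a_{n+1})=(-1)^{q|a_1|}a_1\varphi(a_2,\dots,a_{n+1})+\sum_{i=1}^n(-1)^i\varphi(a_1,\dots,a_ia_{i+1},\dots,a_{n+1})+(-1)^{n+1}\varphi(a_1,\dots,a_n)a_{n+1}.$$ 1. Let $n\ge3$. If $m_l=0$ for $2<l<n$ and $HH^{n,2-n}(A,m_2)=0$, then there are a minimal $A_\infty$-structure $m'$ on $A$ with $m'_2=m_2$ and $m'_l=0$ for $2<l\le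 n$, and an $A_\infty$-isomorphism $f\colon(A,m)\to(A,m')$ with $f_1=\mathrm{id}$ and $f_l=0$ for $1<l<n-1$. 2. Let $M\ge0$. If $HH^{n,2-n}(A,m_2)=0$ for $3\le n\le M$, then there are a minimal $A_\infty$-structure $m'$ on $A$ with $m'_2=m_2$ and $m'_l=0$ for $3\le l\le M$, and an $A_\infty$-isomorphism $f\colon(A,m)\to(A,m')$ with $f_1=\mathrm{id}$. 3. If $HH^{n,2-n}(A,m_2)=0$ for all $n\ge3$, then there are minimal $A_\infty$-structures $m=m^{(0)},m^{(1)},m^{(2)},\dots$ on $A$, with $m^{(j)}_2=m_2$ and $m^{(j)}_l=0$ for $3\le l\le j+2$, and $A_\infty$-isomorphisms $g^{(j)}\colon(A,m^{(j)})\to(A,m^{(j+1)})$ with $g^{(j)}_1=\mathrm{id}$ and $g^{(j)}_l=0$ for $1<l<j+2$, such that the composites $F^{(j)}=g^{(j-1)}\circ\cdots\circ g^{(0)}$ converge: there is an $A_\infty$-isomorphism $\Phi$ from $(A,m)$ to the trivial $A_\infty$-algebra with the single operation $m_2$ such that $\Phi_1=\mathrm{id}$ and $F^{(j)}_n=\Phi_n$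 whenever $j\ge n-1$. In particular $(A,m)$ is formal. -/

import Mathlib

/-!
# Minimal A-infinity algebras, Hochschild cohomology and formality

Gradings are indexed by `ZMod N` with `N` even: `N = 0` gives `ℤ`-graded modules (`ZMod 0 = ℤ`) and
`N = 2` gives `ℤ/2`-graded ones.  A `k`-linear map `V^{⊗n} → W` is a `MultilinearMap` on `Fin n → V`.
To avoid reindexing, the arguments `a₁, …, aₙ` of such maps are the first terms `a 0, …, a (n - 1)`
of a sequence `a : ℕ → V`; the other terms play no role.
-/

namespace AInf

section Graded

variable {k : Type*} [Field k] {N : ℕ}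
variable {V : Type*} [AddCommGroup V] [Module k V]
variable {W : Type*} [AddCommGroup W] [Module k W]
variable {X : Type*} [AddCommGroup X] [Module k X]

/-- `φ : V^{⊗n} → W` is homogeneous of degree `q`. -/
def IsHomogeneous (𝒜 : ZMod N → Submodule k V) (ℬ : ZMod N → Submodule k W) {n : ℕ}
    (φ : MultilinearMap k (fun _ : Fin n => V) W) (q : ℤ) : Prop :=
  ∀ (d : Fin n → ZMod N) (a : Fin n → V), (∀ i, a i ∈ 𝒜 (d i)) →
    φ a ∈ ℬ ((∑ i, d i) + (q : ZMod N))

/-- The linear map `x ↦ (-1)^{q |x|} x`: the Koszul sign for moving a map of degree `q` past `x`.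
For even `N` the parity of `d : ZMod N` is the parity of `d.val` (if `N = 0`, of `|d|`). -/
noncomputable def koszul (𝒜 : ZMod N → Submodule k V) [DirectSum.Decomposition 𝒜] (q : ℤ) :
    V →ₗ[k] V :=
  (DirectSum.toModule k (ZMod N) V
      (fun d => ((-1 : k) ^ (q.natAbs * d.val)) • (𝒜 d).subtype)).comp
    (DirectSum.decomposeLinearEquiv 𝒜).toLinearMap

theorem koszul_of_mem (𝒜 : ZMod N → Submodule k V) [DirectSum.Decomposition 𝒜] (q : ℤ)
    {d : ZMod N} {x : V} (hx : x ∈ 𝒜 d) :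
    koszul 𝒜 q x = ((-1 : k) ^ (q.natAbs * d.val)) • x := by
  have h : DirectSum.decomposeLinearEquiv 𝒜 x = DirectSum.lof k (ZMod N) (fun i => 𝒜 i) d ⟨x, hx⟩ :=
    DirectSum.decompose_of_mem 𝒜 hx
  simp only [koszul, LinearMap.comp_apply, LinearEquiv.coe_coe, h, DirectSum.toModule_lof,
    LinearMap.smul_apply, Submodule.subtype_apply]

/-- `(id^{⊗r} ⊗ φ ⊗ id^{⊗t})(a)` for `φ : V^{⊗s} → V` of degree `q`, as a sequence of elements: the
Koszul rule puts the sign `(-1)^{q |a_i|}` on the `r` arguments standing before `φ`. -/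
noncomputable def splice (𝒜 : ZMod N → Submodule k V) [DirectSum.Decomposition 𝒜] (q : ℤ) (r : ℕ)
    {s : ℕ} (φ : MultilinearMap k (fun _ : Fin s => V) V) (a : ℕ → V) : ℕ → V :=
  fun i => if i < r then koszul 𝒜 q (a i)
    else if i = r then φ (fun j => a (r + j))
    else a (i + s - 1)

/-- `∑_{r+s+t=n, s≥1} (-1)^{rs+t} f_{r+1+t} (id^{⊗r} ⊗ m_s ⊗ id^{⊗t})` at `a₁, …, aₙ`, where `m_s` has
degree `2 - s`. -/
noncomputable def insertSum (𝒜 : ZMod N → Submodule k V) [DirectSum.Decomposition 𝒜]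
    (f : ∀ n : ℕ, MultilinearMap k (fun _ : Fin n => V) W)
    (m : ∀ n : ℕ, MultilinearMap k (fun _ : Fin n => V) V) (n : ℕ) (a : ℕ → V) : W :=
  ∑ s ∈ Finset.Icc 1 n, ∑ r ∈ Finset.range (n - s + 1),
    ((-1 : k) ^ (r * s + (n - r - s))) •
      f (n - s + 1) (fun i => splice 𝒜 (2 - (s : ℤ)) r (m s) a i)

/-- `∑ (-1)^♥ g_l (f_{i₁} ⊗ ⋯ ⊗ f_{i_l})` at `a₁, …, aₙ`, over all `i₁ + ⋯ + i_l = n` with `i_j ≥ 1`,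
where `f_i` has degree `1 - i` and `♥ = ∑_j (i_j - 1) (i₁ + ⋯ + i_{j-1})`.  By the Koszul rule each
argument of the `j`-th factor gets the sign for all the factors `f_{i_{j'}}`, `j' > j`. -/
noncomputable def compSum (𝒜 : ZMod N → Submodule k V) [DirectSum.Decomposition 𝒜]
    (g : ∀ n : ℕ, MultilinearMap k (fun _ : Fin n => W) X)
    (f : ∀ n : ℕ, MultilinearMap k (fun _ : Fin n => V) W) (n : ℕ) (a : ℕ → V) : X :=
  ∑ c : Composition n,
    ((-1 : k) ^ (∑ j : Fin c.length, (c.blocksFun j - 1) * c.sizeUpTo j)) •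
      g c.length (fun j => f (c.blocksFun j) (fun i =>
        koszul 𝒜 (∑ j' ∈ Finset.Ioi j, (1 - (c.blocksFun j' : ℤ))) (a (c.sizeUpTo j + i))))

/-- The components of the identity morphism: `id` in arity `1` and zero in all other arities. -/
noncomputable def idMaps (k V : Type*) [Field k] [AddCommGroup V] [Module k V] :
    ∀ n : ℕ, MultilinearMap k (fun _ : Fin n => V) V
  | 1 => MultilinearMap.ofSubsingleton k V V 0 LinearMap.id
  | _ => 0

/-- A multilinear map of arity one as a linear map. -/
noncomputable def linearPart (φ : MultilinearMap k (fun _ : Fin 1 => V) W) : V →ₗ[k] W :=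
  (MultilinearMap.ofSubsingleton k V W 0).symm φ

end Graded

/-- A (non-curved) A-infinity structure on the graded vector space `𝒜`.  There is no operation of
arity `0`; it is recorded as `m 0 = 0`. -/
structure Algebra {k : Type*} [Field k] {N : ℕ} {V : Type*} [AddCommGroup V] [Module k V]
    (𝒜 : ZMod N → Submodule k V) [DirectSum.Decomposition 𝒜] where
  m : ∀ n : ℕ, MultilinearMap k (fun _ : Fin n => V) V
  m_zero : m 0 = 0
  homogeneous : ∀ n : ℕ, 1 ≤ n → IsHomogeneous 𝒜 𝒜 (m n) (2 - (n : ℤ))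
  relation : ∀ n : ℕ, 1 ≤ n → ∀ a : ℕ → V, insertSum 𝒜 m m n a = 0

/-- A morphism of A-infinity algebras.  There is no component of arity `0`; it is recorded as
`f 0 = 0`. -/
structure Hom {k : Type*} [Field k] {N : ℕ} {V : Type*} [AddCommGroup V] [Module k V]
    {𝒜 : ZMod N → Submodule k V} [DirectSum.Decomposition 𝒜]
    {W : Type*} [AddCommGroup W] [Module k W]
    {ℬ : ZMod N → Submodule k W} [DirectSum.Decomposition ℬ]
    (A : Algebra 𝒜) (B : Algebra ℬ) where
  f : ∀ n : ℕ, MultilinearMap k (fun _ : Fin n => V) W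
  f_zero : f 0 = 0
  homogeneous : ∀ n : ℕ, 1 ≤ n → IsHomogeneous 𝒜 ℬ (f n) (1 - (n : ℤ))
  relation : ∀ n : ℕ, 1 ≤ n → ∀ a : ℕ → V, compSum 𝒜 B.m f n a = insertSum 𝒜 f A.m n a

section Properties

variable {k : Type*} [Field k] {N : ℕ}
variable {V : Type*} [AddCommGroup V] [Module k V]
variable {𝒜 : ZMod N → Submodule k V} [DirectSum.Decomposition 𝒜]
variable {W : Type*} [AddCommGroup W] [Module k W]
variable {ℬ : ZMod N → Submodule k W} [DirectSum.Decomposition ℬ]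
variable {X : Type*} [AddCommGroup X] [Module k X]
variable {𝒞 : ZMod N → Submodule k X} [DirectSum.Decomposition 𝒞]

/-- The differential `m₁`. -/
noncomputable def Algebra.d (A : Algebra 𝒜) : V →ₗ[k] V := linearPart (A.m 1)

/-- `A` is minimal: `m₁ = 0`. -/
def Algebra.IsMinimal (A : Algebra 𝒜) : Prop := A.m 1 = 0

/-- The only operation of `A` is the product `m₂`. -/
def Algebra.IsTrivial (A : Algebra 𝒜) : Prop := ∀ n : ℕ, n ≠ 2 → A.m n = 0

/-- `H` is the composite of `F : A → B` and `G : B → C`. -/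
def Hom.IsComp {A : Algebra 𝒜} {B : Algebra ℬ} {C : Algebra 𝒞}
    (G : Hom B C) (F : Hom A B) (H : Hom A C) : Prop :=
  ∀ n : ℕ, 1 ≤ n → ∀ a : ℕ → V, H.f n (fun i => a i) = compSum 𝒜 G.f F.f n a

/-- `F` is an isomorphism of A-infinity algebras: it has a two-sided inverse. -/
def Hom.IsIso {A : Algebra 𝒜} {B : Algebra ℬ} (F : Hom A B) : Prop :=
  ∃ G : Hom B A,
    (∀ n : ℕ, 1 ≤ n → ∀ a : ℕ → V, compSum 𝒜 G.f F.f n a = idMaps k V n (fun i => a i)) ∧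
    (∀ n : ℕ, 1 ≤ n → ∀ b : ℕ → W, compSum ℬ F.f G.f n b = idMaps k W n (fun i => b i))

/-- `F` is a quasi-isomorphism: the map induced by `f₁` on the cohomology `ker m₁ / im m₁` is
injective and surjective. -/
def Hom.IsQuasiIso {A : Algebra 𝒜} {B : Algebra ℬ} (F : Hom A B) : Prop :=
  (∀ x ∈ LinearMap.ker A.d, linearPart (F.f 1) x ∈ LinearMap.range B.d → x ∈ LinearMap.range A.d) ∧
  (∀ y ∈ LinearMap.ker B.d, ∃ x ∈ LinearMap.ker A.d,
    linearPart (F.f 1) x - y ∈ LinearMap.range B.d)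

end Properties

/-- `A` is formal: it is quasi-isomorphic to an A-infinity algebra whose only operation is `m₂` (which
is then isomorphic to the cohomology algebra of `A`). -/
def Algebra.IsFormal.{u, v} {k : Type u} [Field k] {N : ℕ} {V : Type v} [AddCommGroup V] [Module k V]
    {𝒜 : ZMod N → Submodule k V} [DirectSum.Decomposition 𝒜] (A : Algebra 𝒜) : Prop :=
  ∃ (W : Type v) (_ : AddCommGroup W) (_ : Module k W) (ℬ : ZMod N → Submodule k W)
    (_ : DirectSum.Decomposition ℬ) (B : Algebra ℬ) (F : Hom A B), B.IsTrivial ∧ F.IsQuasiIso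

section Hochschild

variable {k : Type*} [Field k] {N : ℕ} {V : Type*} [AddCommGroup V] [Module k V]
variable (𝒜 : ZMod N → Submodule k V) [DirectSum.Decomposition 𝒜]

/-- The Hochschild cochains `V^{⊗n} → V` that are homogeneous of degree `q`. -/
def hochschildCochains (n : ℕ) (q : ℤ) : Submodule k (MultilinearMap k (fun _ : Fin n => V) V) where
  carrier := {φ | IsHomogeneous 𝒜 𝒜 φ q}
  add_mem' hφ hψ := fun d a ha => Submodule.add_mem _ (hφ d a ha) (hψ d a ha)
  zero_mem' := fun _ _ _ => Submodule.zero_mem _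
  smul_mem' c _ hφ := fun d a ha => Submodule.smul_mem _ c (hφ d a ha)

/-- A multilinear map as a function of sequences (of which only the first `n` terms matter). -/
def evalSeq (k V : Type*) [Field k] [AddCommGroup V] [Module k V] (n : ℕ) :
    MultilinearMap k (fun _ : Fin n => V) V →ₗ[k] ((ℕ → V) → V) where
  toFun φ := fun a => φ (fun i => a i)
  map_add' _ _ := rfl
  map_smul' _ _ := rfl

/-- The Hochschild differential, on `n`-cochains of degree `q`, of the graded algebra with product
`μ`:
`(dφ)(a₁, …, a_{n+1}) = (-1)^{q |a₁|} a₁ φ(a₂, …, a_{n+1})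
  + ∑_{1 ≤ i ≤ n} (-1)^i φ(a₁, …, a_i a_{i+1}, …, a_{n+1}) + (-1)^{n+1} φ(a₁, …, a_n) a_{n+1}`,
as a function of sequences (of which only the first `n + 1` terms matter). -/
noncomputable def hochschildDiff (μ : MultilinearMap k (fun _ : Fin 2 => V) V) (n : ℕ) (q : ℤ) :
    MultilinearMap k (fun _ : Fin n => V) V →ₗ[k] ((ℕ → V) → V) where
  toFun φ := fun a =>
    μ ![koszul 𝒜 q (a 0), φ (fun i => a (i + 1))]
      + ∑ r ∈ Finset.range n, ((-1 : k) ^ (r + 1)) • φ (fun i => splice 𝒜 0 r μ a i)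
      + ((-1 : k) ^ (n + 1)) • μ ![φ (fun i => a i), a n]
  map_add' φ ψ := by
    have h1 : ∀ x y z : V, μ ![x, y + z] = μ ![x, y] + μ ![x, z] := fun x y z => by
      have e : ∀ w : V, Function.update ![x, 0] (1 : Fin 2) w = ![x, w] := fun w => by
        funext i; fin_cases i <;> simp
      simpa only [e] using μ.map_update_add ![x, 0] 1 y z
    have h2 : ∀ x y z : V, μ ![y + z, x] = μ ![y, x] + μ ![z, x] := fun x y z => by
      have e : ∀ w : V, Function.update ![0, x] (0 : Fin 2) w = ![w, x] := fun w => by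
        funext i; fin_cases i <;> simp
      simpa only [e] using μ.map_update_add ![0, x] 0 y z
    funext a
    simp only [_root_.add_apply, Pi.add_apply, h1, h2, smul_add, Finset.sum_add_distrib]
    abel
  map_smul' c φ := by
    have h1 : ∀ x y : V, μ ![x, c • y] = c • μ ![x, y] := fun x y => by
      have e : ∀ w : V, Function.update ![x, 0] (1 : Fin 2) w = ![x, w] := fun w => by
        funext i; fin_cases i <;> simp
      simpa only [e] using μ.map_update_smul ![x, 0] 1 c y
    have h2 : ∀ x y : V, μ ![c • y, x] = c • μ ![y, x] := fun x y => by
      have e : ∀ w : V, Function.update ![0, x] (0 : Fin 2) w = ![w, x] := fun w => by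
        funext i; fin_cases i <;> simp
      simpa only [e] using μ.map_update_smul ![0, x] 0 c y
    funext a
    simp only [_root_.smul_apply, Pi.smul_apply, h1, h2, smul_add, Finset.smul_sum,
      RingHom.id_apply, smul_comm c]

/-- Hochschild `n`-cocycles of degree `q`. -/
noncomputable def hochschildCocycles (μ : MultilinearMap k (fun _ : Fin 2 => V) V) (n : ℕ) (q : ℤ) :
    Submodule k (MultilinearMap k (fun _ : Fin n => V) V) :=
  hochschildCochains 𝒜 n q ⊓ LinearMap.ker (hochschildDiff 𝒜 μ n q)

/-- Hochschild `n`-coboundaries of degree `q`: the maps `dψ` for an `(n-1)`-cochain `ψ` of degree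
`q`. -/
noncomputable def hochschildCoboundaries (μ : MultilinearMap k (fun _ : Fin 2 => V) V) :
    ∀ (n : ℕ) (_ : ℤ), Submodule k (MultilinearMap k (fun _ : Fin n => V) V)
  | 0, _ => ⊥
  | n + 1, q => hochschildCochains 𝒜 (n + 1) q ⊓
      ((hochschildCochains 𝒜 n q).map (hochschildDiff 𝒜 μ n q)).comap (evalSeq k V (n + 1))

/-- The Hochschild cohomology `HH^{n,q}` (arity `n`, internal degree `q`) of the graded associative
algebra with product `μ`, with coefficients in itself. -/
abbrev HochschildCohomology (μ : MultilinearMap k (fun _ : Fin 2 => V) V) (n : ℕ) (q : ℤ) : Type _ :=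
  hochschildCocycles 𝒜 μ n q ⧸
    (hochschildCoboundaries 𝒜 μ n q).comap (hochschildCocycles 𝒜 μ n q).subtype

end Hochschild

end AInf

/-!
Lower all degrees by one.  An `A∞`-structure on `V` is then a coderivation of degree one and square
zero of the tensor coalgebra of `V` (the bar construction), a morphism is a map of such coalgebras,
and all the signs of the definitions are absorbed.  A coalgebra endomorphism whose linear part is
the identity is invertible, because its inverse can be computed by induction on the length of words;
so an `A∞`-structure can be transported along any family of maps `f` with `f₁ = id`, and every
morphism with `f₁ = id` is an isomorphism.

If all higher products of a minimal `m` of arity less than `n` vanish, the `A∞`-relation of arity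
`n + 1` says that `mₙ` is a Hochschild cocycle.  Transport along the identity perturbed by a single
component `φ` of arity `n - 1` leaves the products of arity less than `n` unchanged and changes `mₙ`
by `± dφ`.  Hence `mₙ` can be removed if its class vanishes.  The step that removes `mₙ` does not
change the components of arity less than `n - 1` of the composites formed before it, so these
stabilize in every arity.
-/

namespace AInf

section LinearMaps

variable {k V X Y : Type*} [CommSemiring k] [AddCommMonoid V] [Module k V]
  [AddCommMonoid X] [Module k X] [AddCommMonoid Y] [Module k Y]

theorem isLinearMap_zero : IsLinearMap k (fun _ : V => (0 : X)) :=
  (0 : V →ₗ[k] X).isLinear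

theorem isLinearMap_add {Φ Ψ : V → X} (hΦ : IsLinearMap k Φ) (hΨ : IsLinearMap k Ψ) :
    IsLinearMap k (fun x => Φ x + Ψ x) :=
  (hΦ.mk' Φ + hΨ.mk' Ψ).isLinear

theorem isLinearMap_comp {Φ : X → Y} {Ψ : V → X} (hΦ : IsLinearMap k Φ) (hΨ : IsLinearMap k Ψ) :
    IsLinearMap k (fun x => Φ (Ψ x)) :=
  (hΦ.mk' Φ ∘ₗ hΨ.mk' Ψ).isLinear

end LinearMaps

section Deconcatenation

variable {V X Y : Type*} [AddCommMonoid X] [AddCommMonoid Y]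

/-- The sum of `H u v` over all decompositions `w = u ++ v`, the empty ones included: `H` applied
to the deconcatenation coproduct of `w`. -/
def deconcatSum (H : List V → List V → X) (w : List V) : X :=
  ∑ i ∈ Finset.range (w.length + 1), H (w.take i) (w.drop i)

theorem deconcatSum_nil (H : List V → List V → X) : deconcatSum H [] = H [] [] := by
  simp [deconcatSum]

theorem deconcatSum_cons (H : List V → List V → X) (x : V) (w : List V) :
    deconcatSum H (x :: w) = H [] (x :: w) + deconcatSum (fun u v => H (x :: u) v) w := by
  rw [deconcatSum, List.length_cons, Finset.sum_range_succ', add_comm]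
  rfl

theorem deconcatSum_congr {H H' : List V → List V → X} {w : List V}
    (h : ∀ u v, u ++ v = w → H u v = H' u v) : deconcatSum H w = deconcatSum H' w :=
  Finset.sum_congr rfl fun _ _ => h _ _ (List.take_append_drop ..)

theorem deconcatSum_zero (w : List V) : deconcatSum (fun _ _ => (0 : X)) w = 0 :=
  Finset.sum_const_zero

theorem deconcatSum_add (H H' : List V → List V → X) (w : List V) :
    deconcatSum (fun u v => H u v + H' u v) w = deconcatSum H w + deconcatSum H' w :=
  Finset.sum_add_distrib

theorem map_deconcatSum (L : X →+ Y) (H : List V → List V → X) (w : List V) :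
    L (deconcatSum H w) = deconcatSum (fun u v => L (H u v)) w :=
  map_sum L _ _

theorem deconcatSum_assoc (K : List V → List V → List V → X) (w : List V) :
    deconcatSum (fun u v => deconcatSum (K u) v) w =
      deconcatSum (fun u v => deconcatSum (fun u₁ u₂ => K u₁ u₂ v) u) w := by
  induction w generalizing K with
  | nil => simp only [deconcatSum_nil]
  | cons x w ih => simp only [deconcatSum_cons, deconcatSum_nil, ih, deconcatSum_add, add_assoc]

theorem deconcatSum_eq_nil_left {H : List V → List V → X} (h : ∀ x u v, H (x :: u) v = 0)
    (w : List V) : deconcatSum H w = H [] w := by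
  cases w with
  | nil => exact deconcatSum_nil H
  | cons x w => simp only [deconcatSum_cons, h, deconcatSum_zero, add_zero]

theorem deconcatSum_eq_nil_right {H : List V → List V → X} (h : ∀ u x v, H u (x :: v) = 0)
    (w : List V) : deconcatSum H w = H w [] := by
  induction w generalizing H with
  | nil => exact deconcatSum_nil H
  | cons x w ih => rw [deconcatSum_cons, h, zero_add, ih fun u y v => h _ y v]

end Deconcatenation

section Multilinear

variable {k V X : Type*} [CommSemiring k] [AddCommMonoid V] [Module k V]
  [AddCommMonoid X] [Module k X]

/-- A function of words that is linear in each letter, that is, a linear map out of the tensor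
module of `V`. -/
def IsWordMultilinear (k : Type*) {V X : Type*} [CommSemiring k] [AddCommMonoid V] [Module k V]
    [AddCommMonoid X] [Module k X] (Φ : List V → X) : Prop :=
  ∀ u v, IsLinearMap k (fun x => Φ (u ++ x :: v))

theorem IsWordMultilinear.cons {Φ : List V → X} (h : IsWordMultilinear k Φ) (y : V) :
    IsWordMultilinear k (fun w => Φ (y :: w)) :=
  fun u v => h (y :: u) v

theorem IsWordMultilinear.head {Φ : List V → X} (h : IsWordMultilinear k Φ) (v : List V) :
    IsLinearMap k (fun x => Φ (x :: v)) :=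
  h [] v

theorem IsWordMultilinear.zero_cons {Φ : List V → X} (h : IsWordMultilinear k Φ) (v : List V) :
    Φ (0 :: v) = 0 :=
  (h.head v).map_zero

theorem IsWordMultilinear.add {Φ Ψ : List V → X} (hΦ : IsWordMultilinear k Φ)
    (hΨ : IsWordMultilinear k Ψ) : IsWordMultilinear k (fun w => Φ w + Ψ w) :=
  fun u v => isLinearMap_add (hΦ u v) (hΨ u v)

theorem IsWordMultilinear.smul {Φ : List V → X} (hΦ : IsWordMultilinear k Φ) (c : k) :
    IsWordMultilinear k (fun w => c • Φ w) :=
  fun u v => isLinearMap_comp (IsLinearMap.isLinearMap_smul c) (hΦ u v)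

theorem IsWordMultilinear.sub {k V X : Type*} [CommRing k] [AddCommGroup V] [Module k V]
    [AddCommGroup X] [Module k X] {Φ Ψ : List V → X} (hΦ : IsWordMultilinear k Φ)
    (hΨ : IsWordMultilinear k Ψ) : IsWordMultilinear k (fun w => Φ w - Ψ w) := by
  simpa only [sub_eq_add_neg, neg_one_smul] using hΦ.add (hΨ.smul (-1))

theorem isLinearMap_deconcatSum {V : Type*} {Z : Type*} [AddCommMonoid Z] [Module k Z]
    {H : Z → List V → List V → X} (h : ∀ u v, IsLinearMap k (fun z => H z u v)) (w : List V) :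
    IsLinearMap k (fun z => deconcatSum (H z) w) := by
  have eq_sum : (fun z => deconcatSum (H z) w) =
      ⇑(∑ i ∈ Finset.range (w.length + 1), (h (w.take i) (w.drop i)).mk' _) := by
    funext z; simp [deconcatSum]
  exact eq_sum ▸ LinearMap.isLinear _

theorem IsWordMultilinear.deconcatSum {H : List V → List V → X}
    (hl : ∀ v, IsWordMultilinear k (fun u => H u v)) (hr : ∀ u, IsWordMultilinear k (H u)) :
    IsWordMultilinear k (deconcatSum H) := by
  intro u v
  induction u generalizing H with
  | nil =>
    simp only [List.nil_append, deconcatSum_cons]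
    exact isLinearMap_add ((hr []).head v) (isLinearMap_deconcatSum (fun a c => (hl c).head a) v)
  | cons y u ih =>
    simp only [List.cons_append, deconcatSum_cons]
    exact isLinearMap_add (hr [] (y :: u) v) (ih (fun c => (hl c).cons y) fun a => hr (y :: a))

end Multilinear

section Pullback

variable {V W X Y : Type*} [AddCommMonoid X] [AddCommMonoid Y]

/-- The sum of `Φ [g u₀, f u₁, …, f u_l]` over all decompositions `w = u₀ ++ u₁ ++ ⋯ ++ u_l` in
which only `u₀` may be empty; this generalization of `pullback` makes the recursion structural. -/
def pullbackAux (f g : List V → W) (Φ : List W → X) : List V → X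
  | [] => Φ [g []]
  | x :: w => pullbackAux f (fun u => g (x :: u)) Φ w +
      pullbackAux f (fun u => f (x :: u)) (fun v => Φ (g [] :: v)) w

/-- The sum of `Φ [f u₁, …, f u_l]` over all decompositions `w = u₁ ++ ⋯ ++ u_l` into non-empty
words: the composite of `Φ` with the morphism of tensor coalgebras with corestriction `f`. -/
def pullback (f : List V → W) (Φ : List W → X) : List V → X
  | [] => Φ []
  | x :: w => pullbackAux f (fun u => f (x :: u)) Φ w

theorem pullback_nil (f : List V → W) (Φ : List W → X) : pullback f Φ [] = Φ [] := rfl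

theorem pullbackAux_eq_deconcatSum (f g : List V → W) (Φ : List W → X) (w : List V) :
    pullbackAux f g Φ w = deconcatSum (fun u v => pullback f (fun t => Φ (g u :: t)) v) w := by
  induction w generalizing Φ g with
  | nil => simp only [pullbackAux, deconcatSum_nil, pullback]
  | cons x w ih => rw [pullbackAux, ih, deconcatSum_cons, add_comm]; rfl

theorem pullback_cons (f : List V → W) (Φ : List W → X) (x : V) (w : List V) :
    pullback f Φ (x :: w) =
      deconcatSum (fun u v => pullback f (fun t => Φ (f (x :: u) :: t)) v) w :=
  pullbackAux_eq_deconcatSum ..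

theorem map_pullbackAux (L : X →+ Y) (f g : List V → W) (Φ : List W → X) (w : List V) :
    L (pullbackAux f g Φ w) = pullbackAux f g (fun v => L (Φ v)) w := by
  induction w generalizing Φ g with
  | nil => rfl
  | cons x w ih => simp only [pullbackAux, map_add, ih]

theorem map_pullback (L : X →+ Y) (f : List V → W) (Φ : List W → X) (w : List V) :
    L (pullback f Φ w) = pullback f (fun v => L (Φ v)) w := by
  cases w with
  | nil => rfl
  | cons x w => exact map_pullbackAux ..

theorem pullbackAux_add (f g : List V → W) (Φ Ψ : List W → X) (w : List V) :
    pullbackAux f g (fun v => Φ v + Ψ v) w = pullbackAux f g Φ w + pullbackAux f g Ψ w := by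
  induction w generalizing Φ Ψ g with
  | nil => rfl
  | cons x w ih => simp only [pullbackAux, ih, add_add_add_comm]

theorem pullback_add (f : List V → W) (Φ Ψ : List W → X) (w : List V) :
    pullback f (fun v => Φ v + Ψ v) w = pullback f Φ w + pullback f Ψ w := by
  cases w with
  | nil => rfl
  | cons x w => exact pullbackAux_add ..

theorem pullback_zero (f : List V → W) (w : List V) : pullback f (fun _ => (0 : X)) w = 0 :=
  (map_pullback (0 : X →+ X) f (fun _ => 0) w).symm

theorem pullback_cons_eq_zero (f : List V → W) {Φ : List W → X} (h : ∀ y v, Φ (y :: v) = 0)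
    (x : V) (w : List V) : pullback f Φ (x :: w) = 0 := by
  simp only [pullback_cons, h, pullback_zero, deconcatSum_zero]

theorem pullbackAux_congr (f g : List V → W) {Φ Ψ : List W → X} {w : List V}
    (h : ∀ v : List W, v.length ≤ w.length + 1 → Φ v = Ψ v) :
    pullbackAux f g Φ w = pullbackAux f g Ψ w := by
  induction w generalizing Φ Ψ g with
  | nil => exact h _ le_rfl
  | cons x w ih =>
    rw [pullbackAux, pullbackAux, ih _ fun v hv => h v (hv.trans (Nat.le_succ _)),
      ih _ fun v hv => h (g [] :: v) (Nat.succ_le_succ hv)]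

theorem pullback_congr (f : List V → W) {Φ Ψ : List W → X} {w : List V}
    (h : ∀ v : List W, v.length ≤ w.length → Φ v = Ψ v) : pullback f Φ w = pullback f Ψ w := by
  cases w with
  | nil => exact h [] le_rfl
  | cons x w => exact pullbackAux_congr f _ h

theorem pullback_deconcatSum (f : List V → W) (H : List W → List W → X) (w : List V) :
    pullback f (deconcatSum H) w =
      deconcatSum (fun u v => pullback f (fun u' => pullback f (H u') v) u) w := by
  induction hn : w.length using Nat.strong_induction_on generalizing H w with
  | _ n ih =>
  cases w with
  | nil => simp only [deconcatSum_nil, pullback_nil]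
  | cons x w =>
    have split_tail : ∀ u v, u ++ v = w →
        pullback f (fun t => deconcatSum H (f (x :: u) :: t)) v =
          pullback f (fun t => H [] (f (x :: u) :: t)) v +
          deconcatSum (fun v₁ v₂ =>
            pullback f (fun u' => pullback f (H (f (x :: u) :: u')) v₂) v₁) v := by
      intro u v huv
      simp only [deconcatSum_cons, pullback_add]
      rw [← ih v.length (by simp [← hn, ← huv]) _ v rfl]
    rw [pullback_cons, deconcatSum_congr split_tail, deconcatSum_add,
      deconcatSum_assoc fun u v₁ v₂ =>
        pullback f (fun u' => pullback f (H (f (x :: u) :: u')) v₂) v₁,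
      deconcatSum_cons, pullback_nil, pullback_cons]
    simp only [pullback_cons]

end Pullback

section PullbackMultilinear

variable {k V W U X : Type*} [CommSemiring k] [AddCommMonoid V] [Module k V] [AddCommMonoid W]
  [Module k W] [AddCommMonoid U] [Module k U] [AddCommMonoid X] [Module k X]

theorem isLinearMap_pullbackAux {V W Z : Type*} [AddCommMonoid Z] [Module k Z] {f g : List V → W}
    {Φ : Z → List W → X} (h : ∀ v, IsLinearMap k (fun z => Φ z v)) (w : List V) :
    IsLinearMap k (fun z => pullbackAux f g (Φ z) w) := by
  induction w generalizing Φ g with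
  | nil => exact h _
  | cons x w ih => exact isLinearMap_add (ih h) (ih fun v => h _)

theorem isLinearMap_pullback {V W Z : Type*} [AddCommMonoid Z] [Module k Z] {f : List V → W}
    {Φ : Z → List W → X} (h : ∀ v, IsLinearMap k (fun z => Φ z v)) (w : List V) :
    IsLinearMap k (fun z => pullback f (Φ z) w) := by
  cases w with
  | nil => exact h []
  | cons x w => exact isLinearMap_pullbackAux h w

theorem isLinearMap_pullbackAux_block {V Z : Type*} [AddCommMonoid Z] [Module k Z]
    {f : List V → W} {g : Z → List V → W} (hg : ∀ u, IsLinearMap k (fun z => g z u))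
    {Φ : List W → X} (hΦ : IsWordMultilinear k Φ) (w : List V) :
    IsLinearMap k (fun z => pullbackAux f (g z) Φ w) := by
  induction w generalizing g with
  | nil => exact isLinearMap_comp (Φ := fun y => Φ [y]) (hΦ.head []) (hg [])
  | cons x w ih =>
    exact isLinearMap_add (ih fun u => hg _)
      (isLinearMap_comp (isLinearMap_pullbackAux hΦ.head w) (hg []))

theorem IsWordMultilinear.pullbackAux {f g : List V → W} (hf : IsWordMultilinear k f)
    (hg : IsWordMultilinear k g) {Φ : List W → X} (hΦ : IsWordMultilinear k Φ) :
    IsWordMultilinear k (pullbackAux f g Φ) := by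
  intro u v
  induction u generalizing g Φ with
  | nil =>
    exact isLinearMap_add (isLinearMap_pullbackAux_block hg.head hΦ v)
      (isLinearMap_pullbackAux_block hf.head (hΦ.cons _) v)
  | cons y u ih => exact isLinearMap_add (ih (hg.cons y) hΦ) (ih (hf.cons y) (hΦ.cons _))

theorem IsWordMultilinear.pullback {f : List V → W} (hf : IsWordMultilinear k f) {Φ : List W → X}
    (hΦ : IsWordMultilinear k Φ) : IsWordMultilinear k (pullback f Φ) := by
  rintro (_ | ⟨y, u⟩) v
  · exact isLinearMap_pullbackAux_block hf.head hΦ v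
  · exact hf.pullbackAux (hf.cons y) hΦ u v

theorem pullback_eq_add_deconcatSum {V : Type*} {f : List V → W} (hf : f [] = 0) {Φ : List W → X}
    (hΦ : IsWordMultilinear k Φ) (w : List V) :
    pullback f Φ w = (if w = [] then Φ [] else 0) +
      deconcatSum (fun u v => pullback f (fun t => Φ (f u :: t)) v) w := by
  cases w with
  | nil => simp [deconcatSum_nil, pullback_nil, hf, hΦ.zero_cons]
  | cons x w =>
    simp [deconcatSum_cons, deconcatSum_zero, hf, hΦ.zero_cons, pullback_zero, pullback_cons]

theorem pullback_pullback {V W : Type*} (f : List V → W) {g : List W → U} (hg : g [] = 0)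
    {Φ : List U → X} (hΦ : IsWordMultilinear k Φ) (w : List V) :
    pullback f (pullback g Φ) w = pullback (pullback f g) Φ w := by
  induction hn : w.length using Nat.strong_induction_on generalizing Φ w with
  | _ n ih =>
  cases w with
  | nil => rfl
  | cons x w =>
    rw [funext (pullback_eq_add_deconcatSum hg hΦ), pullback_add,
      pullback_cons_eq_zero _ (by simp), zero_add, pullback_deconcatSum, deconcatSum_cons,
      pullback_nil, hg]
    simp only [hΦ.zero_cons, pullback_zero, zero_add]
    rw [pullback_cons]
    refine deconcatSum_congr fun u v huv => ?_
    have hv : v.length < n := by simp [← hn, ← huv]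
    simp only [fun y => ih v.length hv (hΦ.cons y) v rfl]
    exact (map_pullback ((isLinearMap_pullback (f := pullback f g) hΦ.head v).mk' _).toAddMonoidHom
      f g (x :: u)).symm

end PullbackMultilinear

section Corestriction

variable {V W X : Type*} [AddCommMonoid V] [AddCommMonoid W] [AddCommMonoid X]

/-- The projection of words onto words of length one: the corestriction of the identity morphism
of tensor coalgebras. -/
def letter : List V → V
  | [x] => x
  | _ => 0

theorem letter_nil : letter ([] : List V) = 0 := rfl

theorem letter_singleton (x : V) : letter [x] = x := rfl

theorem letter_cons_cons (x y : V) (w : List V) : letter (x :: y :: w) = 0 := rfl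

theorem IsWordMultilinear.letter {k : Type*} [CommSemiring k] [Module k V] :
    IsWordMultilinear k (letter : List V → V) := by
  rintro (_ | ⟨y, _ | ⟨z, u⟩⟩) (_ | _)
  · exact LinearMap.id.isLinear
  all_goals exact isLinearMap_zero

theorem pullback_letter_left {k : Type*} [CommSemiring k] [Module k V] [Module k X]
    {Φ : List V → X} (hΦ : IsWordMultilinear k Φ) (w : List V) : pullback letter Φ w = Φ w := by
  induction w generalizing Φ with
  | nil => rfl
  | cons x w ih =>
    rw [pullback_cons, deconcatSum_eq_nil_left, letter_singleton]
    · exact ih (hΦ.cons x)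
    · simp only [letter_cons_cons, hΦ.zero_cons, pullback_zero, implies_true]

theorem pullback_letter {V : Type*} {f : List V → W} (hf : f [] = 0) (w : List V) :
    pullback f letter w = f w := by
  cases w with
  | nil => exact hf.symm
  | cons x w =>
    rw [pullback_cons, deconcatSum_eq_nil_right]
    · rfl
    · exact fun u y v => pullback_cons_eq_zero f (fun z t => letter_cons_cons _ z t) y v

end Corestriction

section Insertion

variable {V X Y : Type*} [AddCommMonoid X] [AddCommMonoid Y]

/-- The sum of `Φ (τ u ++ b v :: t)` over all decompositions `w = u ++ v ++ t` with `v` non-empty: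
the composite of `Φ` with the coderivation of the tensor coalgebra with corestriction `b`. The
map `τ` produces the sign for moving `b` past a letter. -/
def insertion (τ : V → V) (b : List V → V) (Φ : List V → X) : List V → X
  | [] => 0
  | x :: w => insertion τ b (fun v => Φ (τ x :: v)) w +
      deconcatSum (fun u v => Φ (b (x :: u) :: v)) w

variable (τ : V → V)

theorem map_insertion (L : X →+ Y) (b : List V → V) (Φ : List V → X) (w : List V) :
    L (insertion τ b Φ w) = insertion τ b (fun v => L (Φ v)) w := by
  induction w generalizing Φ with
  | nil => exact map_zero L
  | cons x w ih => simp only [insertion, map_add, ih, map_deconcatSum]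

theorem insertion_add (b : List V → V) (Φ Ψ : List V → X) (w : List V) :
    insertion τ b (fun v => Φ v + Ψ v) w = insertion τ b Φ w + insertion τ b Ψ w := by
  induction w generalizing Φ Ψ with
  | nil => exact (add_zero 0).symm
  | cons x w ih => simp only [insertion, ih, deconcatSum_add, add_add_add_comm]

theorem insertion_zero (b : List V → V) (w : List V) :
    insertion τ b (fun _ => (0 : X)) w = 0 :=
  (map_insertion τ (0 : X →+ X) b (fun _ => 0) w).symm

theorem insertion_eq_zero (b : List V → V) {Φ : List V → X} (h : ∀ x w, Φ (x :: w) = 0)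
    (w : List V) : insertion τ b Φ w = 0 := by
  cases w with
  | nil => rfl
  | cons x w => simp only [insertion, h, insertion_zero, deconcatSum_zero, add_zero]

theorem insertion_deconcatSum (b : List V → V) (H : List V → List V → X) (w : List V) :
    insertion τ b (deconcatSum H) w =
      deconcatSum (fun u v => insertion τ b (fun u' => H u' v) u +
        insertion τ b (H (u.map τ)) v) w := by
  induction w generalizing H with
  | nil => simp [insertion, deconcatSum_nil]
  | cons x w ih =>
    simp only [insertion, deconcatSum_cons, insertion_add, deconcatSum_add, ih, List.map_cons,
      List.map_nil]
    rw [deconcatSum_assoc (fun u v₁ v₂ => H (b (x :: u) :: v₁) v₂)]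
    ac_rfl

/-- The part of `insertion` in which the first letter stays outside of `b`. -/
def insertionTail (b : List V → V) (Φ : List V → X) : List V → X
  | [] => 0
  | x :: w => insertion τ b (fun v => Φ (τ x :: v)) w

end Insertion

section InsertionMultilinear

variable {k V W X : Type*} [CommSemiring k] [AddCommMonoid V] [Module k V] [AddCommMonoid W]
  [Module k W] [AddCommMonoid X] [Module k X]

theorem isLinearMap_insertion {V Z : Type*} [AddCommMonoid Z] [Module k Z] {τ : V → V}
    {b : List V → V} {Φ : Z → List V → X} (h : ∀ v, IsLinearMap k (fun z => Φ z v)) (w : List V) :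
    IsLinearMap k (fun z => insertion τ b (Φ z) w) := by
  induction w generalizing Φ with
  | nil => exact isLinearMap_zero
  | cons x w ih =>
    exact isLinearMap_add (ih fun v => h _) (isLinearMap_deconcatSum (fun u v => h _) w)

theorem IsWordMultilinear.insertion {τ : V → V} (hτ : IsLinearMap k τ) {b : List V → V}
    (hb : IsWordMultilinear k b) {Φ : List V → X} (hΦ : IsWordMultilinear k Φ) :
    IsWordMultilinear k (insertion τ b Φ) := by
  intro u v
  induction u generalizing Φ with
  | nil =>
    exact isLinearMap_add (isLinearMap_comp (isLinearMap_insertion hΦ.head v) hτ)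
      (isLinearMap_deconcatSum (fun u v => isLinearMap_comp (hΦ.head v) (hb.head u)) v)
  | cons y u ih =>
    exact isLinearMap_add (ih (hΦ.cons _)) (IsWordMultilinear.deconcatSum
      (fun t u v => isLinearMap_comp (hΦ.head t) (hb (y :: u) v)) (fun a => hΦ.cons _) u v)

theorem insertion_eq_deconcatSum_add (τ : V → V) {b : List V → V} (hb : b [] = 0)
    {Φ : List V → X} (hΦ : IsWordMultilinear k Φ) (w : List V) :
    insertion τ b Φ w = deconcatSum (fun u v => Φ (b u :: v)) w + insertionTail τ b Φ w := by
  cases w with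
  | nil => simp [insertion, deconcatSum_nil, insertionTail, hb, hΦ.zero_cons]
  | cons x w => simp [insertion, deconcatSum_cons, insertionTail, hb, hΦ.zero_cons, add_comm]

theorem insertion_pullback {V : Type*} [AddCommMonoid V] {τ : V → V} {τ' : W → W}
    {b : List V → V} {b' : List W → W} {f : List V → W} (hb' : b' [] = 0) (hf : f [] = 0)
    (hfτ : ∀ u, f (u.map τ) = τ' (f u)) (h : ∀ w, pullback f b' w = insertion τ b f w)
    {Φ : List W → X} (hΦ : IsWordMultilinear k Φ) (w : List V) :
    insertion τ b (pullback f Φ) w = pullback f (insertion τ' b' Φ) w := by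
  induction hn : w.length using Nat.strong_induction_on generalizing Φ w with
  | _ n ih =>
  cases w with
  | nil => rfl
  | cons x w =>
    rw [funext (pullback_eq_add_deconcatSum hf hΦ), insertion_add,
      insertion_eq_zero _ _ (by simp), zero_add, insertion_deconcatSum, deconcatSum_add,
      funext (insertion_eq_deconcatSum_add τ' hb' hΦ), pullback_add, pullback_deconcatSum]
    congr 1
    · refine deconcatSum_congr fun u v _ => ?_
      let L := ((isLinearMap_pullback (f := f) hΦ.head v).mk' _).toAddMonoidHom
      exact ((map_insertion τ L b f u).symm.trans (congrArg L (h u).symm)).trans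
        (map_pullback L f b' u)
    · rw [deconcatSum_cons, pullback_cons, List.map_nil, hf]
      simp only [hΦ.zero_cons, pullback_zero, insertion_zero, zero_add, hfτ, insertionTail]
      refine deconcatSum_congr fun u v huv => ?_
      exact ih v.length (by simp [← hn, ← huv]) (hΦ.cons _) v rfl

theorem insertion_insertion {k V X : Type*} [CommRing k] [AddCommGroup V] [Module k V]
    [AddCommGroup X] [Module k X] {τ : V → V} {b : List V → V} (hb : b [] = 0)
    (hbτ : ∀ u, b (u.map τ) = -τ (b u)) (h : ∀ w, insertion τ b b w = 0) {Φ : List V → X}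
    (hΦ : IsWordMultilinear k Φ) (w : List V) : insertion τ b (insertion τ b Φ) w = 0 := by
  induction w generalizing Φ with
  | nil => rfl
  | cons x w ih =>
    have both_in_one : ∀ u v, insertion τ b (fun u' => Φ (b u' :: v)) u = 0 := fun u v => by
      refine (map_insertion τ ((hΦ.head v).mk' _).toAddMonoidHom b b u).symm.trans ?_
      rw [h, map_zero]
    have disjoint_cancel :
        deconcatSum (fun u v => insertion τ b (fun t => Φ (b (u.map τ) :: t)) v) (x :: w) =
          -deconcatSum (fun u v => insertion τ b (fun t => Φ (τ (b (x :: u)) :: t)) v) w := by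
      have neg_insertion : ∀ (Ψ : List V → X) v, insertion τ b (fun t => -Ψ t) v =
          -insertion τ b Ψ v := fun Ψ v => (map_insertion τ (-AddMonoidHom.id X) b Ψ v).symm
      rw [deconcatSum_cons, List.map_nil, hb]
      simp only [hΦ.zero_cons, insertion_zero, zero_add, hbτ, (hΦ.head _).map_neg, neg_insertion]
      exact (map_deconcatSum (-AddMonoidHom.id X) _ w).symm
    rw [funext (insertion_eq_deconcatSum_add τ hb hΦ), insertion_add, insertion_deconcatSum]
    simp only [both_in_one, zero_add, disjoint_cancel]
    simp only [insertion, insertionTail, ih (hΦ.cons _), zero_add, neg_add_cancel]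

end InsertionMultilinear

section Unipotent

variable {k V X : Type*} [CommRing k] [AddCommGroup V] [Module k V] [AddCommGroup X] [Module k X]

/-- The corestrictions of those morphisms of tensor coalgebras whose linear part is the identity. -/
structure IsUnipotent (k : Type*) {V : Type*} [CommRing k] [AddCommGroup V] [Module k V]
    (f : List V → V) : Prop where
  multilinear : IsWordMultilinear k f
  map_nil : f [] = 0
  map_singleton : ∀ x, f [x] = x

theorem pullback_eq_self {V X : Type*} [AddCommMonoid X] {f : List V → V} (hf : ∀ x, f [x] = x)
    {Φ : List V → X} {w : List V} (h : ∀ v : List V, v.length < w.length → Φ v = 0) :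
    pullback f Φ w = Φ w := by
  induction w generalizing Φ with
  | nil => rfl
  | cons x w ih =>
    rw [pullback_cons, deconcatSum, Finset.sum_eq_single_of_mem 0 (by simp)]
    · simpa [hf] using ih (Φ := fun v => Φ (x :: v)) fun v hv => h _ (Nat.succ_lt_succ hv)
    · intro i hi hi0
      rw [Finset.mem_range] at hi
      have short : ∀ v : List V, v.length ≤ (w.drop i).length → Φ (f (x :: w.take i) :: v) = 0 :=
        fun v hv => h _ (by simp at hv ⊢; omega)
      rw [pullback_congr f short, pullback_zero]

/-- The `n`-th approximation to the solution `g` of `pullback f g = letter`: it is exact on words of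
length at most `n + 1` if `f` is the identity on letters. -/
def substInvApprox (f : List V → V) : ℕ → List V → V
  | 0 => letter
  | n + 1 => fun w => substInvApprox f n w + (letter w - pullback f (substInvApprox f n) w)

/-- The corestriction of the inverse of the morphism of tensor coalgebras with corestriction `f`,
for unipotent `f`. -/
def substInv (f : List V → V) (w : List V) : V := substInvApprox f w.length w

variable {f : List V → V}

theorem IsUnipotent.pullback_substInvApprox (hf : IsUnipotent k f) {n : ℕ} {w : List V}
    (hw : w.length < n + 2) : pullback f (substInvApprox f n) w = letter w := by
  induction n generalizing w with
  | zero =>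
    rw [substInvApprox, pullback_letter hf.map_nil]
    match w, hw with
    | [], _ => exact hf.map_nil
    | [x], _ => exact hf.map_singleton x
    | _ :: _ :: _, hw => simp at hw
  | succ n ih =>
    rw [substInvApprox, pullback_add,
      pullback_eq_self (Φ := fun v => letter v - pullback f (substInvApprox f n) v)
        hf.map_singleton fun v hv => sub_eq_zero.2 (ih (by omega)).symm]
    exact add_sub_cancel _ _

theorem IsUnipotent.substInvApprox_eq (hf : IsUnipotent k f) {n : ℕ} {w : List V}
    (hw : w.length ≤ n) : substInvApprox f n w = substInv f w := by
  induction n, hw using Nat.le_induction with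
  | base => rfl
  | succ n hn ih =>
    have exact_at := hf.pullback_substInvApprox (Nat.lt_add_right 1 (Nat.lt_succ_of_le hn))
    simp only [substInvApprox, exact_at, sub_self, add_zero, ih]

theorem IsUnipotent.pullback_substInv (hf : IsUnipotent k f) (w : List V) :
    pullback f (substInv f) w = letter w := by
  rw [pullback_congr f fun v hv => (hf.substInvApprox_eq hv).symm]
  exact hf.pullback_substInvApprox (by omega)

theorem IsUnipotent.substInv (hf : IsUnipotent k f) : IsUnipotent k (substInv f) where
  map_nil := rfl
  map_singleton x := by
    rw [← hf.substInvApprox_eq (n := 1) le_rfl]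
    simp [substInvApprox, pullback, pullbackAux, hf.map_singleton, letter_singleton]
  multilinear u v := by
    have approx : ∀ n, IsWordMultilinear k (substInvApprox f n) := fun n => by
      induction n with
      | zero => exact IsWordMultilinear.letter
      | succ n ih =>
        exact ih.add (IsWordMultilinear.letter.sub (hf.multilinear.pullback ih))
    have length_eq (x : V) : (u ++ x :: v).length = u.length + (v.length + 1) := by simp
    simpa only [AInf.substInv, length_eq] using approx _ u v

theorem IsUnipotent.substInv_substInv (hf : IsUnipotent k f) :
    AInf.substInv (AInf.substInv f) = f := by
  have hff := hf.substInv.substInv.multilinear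
  funext w
  rw [← pullback_letter hf.map_nil w, ← funext hf.substInv.pullback_substInv,
    pullback_pullback f hf.substInv.map_nil hff, funext hf.pullback_substInv,
    pullback_letter_left hff]

theorem IsUnipotent.pullback_substInv_left (hf : IsUnipotent k f) (w : List V) :
    pullback (AInf.substInv f) f w = letter w := by
  simpa only [hf.substInv_substInv] using hf.substInv.pullback_substInv w

theorem IsUnipotent.pullback_substInv_cancel (hf : IsUnipotent k f) {Φ : List V → X}
    (hΦ : IsWordMultilinear k Φ) (w : List V) :
    pullback f (pullback (AInf.substInv f) Φ) w = Φ w := by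
  rw [pullback_pullback f hf.substInv.map_nil hΦ, funext hf.pullback_substInv,
    pullback_letter_left hΦ]

theorem IsUnipotent.substInv_pullback_cancel (hf : IsUnipotent k f) {Φ : List V → X}
    (hΦ : IsWordMultilinear k Φ) (w : List V) :
    pullback (AInf.substInv f) (pullback f Φ) w = Φ w := by
  rw [pullback_pullback _ hf.map_nil hΦ, funext hf.pullback_substInv_left, pullback_letter_left hΦ]

end Unipotent

section InsertionParts

variable {V X : Type*} [AddCommMonoid X]

theorem insertion_letter {V : Type*} [AddCommMonoid V] (τ : V → V) {b : List V → V}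
    (hb : b [] = 0) (w : List V) : insertion τ b letter w = b w := by
  cases w with
  | nil => exact hb.symm
  | cons x w =>
    rw [insertion, insertion_eq_zero τ b fun y v => letter_cons_cons _ y v, zero_add,
      deconcatSum_eq_nil_right fun u y v => letter_cons_cons _ y v, letter_singleton]

/-- The summands of `insertion τ b Φ w` in which `b` is applied to a word of length `s`. -/
def insertionPart (τ : V → V) (b : List V → V) (Φ : List V → X) (s : ℕ) (w : List V) : X :=
  ∑ r ∈ Finset.range (w.length + 1 - s),
    Φ ((w.take r).map τ ++ b ((w.drop r).take s) :: w.drop (r + s))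

variable (τ : V → V) (b : List V → V) (Φ : List V → X)

theorem insertionPart_cons {s : ℕ} {w : List V} (hs : s ≤ w.length + 1) (x : V) :
    insertionPart τ b Φ s (x :: w) = Φ (b ((x :: w).take s) :: (x :: w).drop s) +
      insertionPart τ b (fun v => Φ (τ x :: v)) s w := by
  rw [insertionPart, List.length_cons, Nat.succ_sub hs, Finset.sum_range_succ', add_comm]
  simp only [Nat.succ_add, insertionPart]
  simp

theorem insertion_eq_sum_insertionPart (w : List V) :
    insertion τ b Φ w = ∑ s ∈ Finset.Icc 1 w.length, insertionPart τ b Φ s w := by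
  induction w generalizing Φ with
  | nil => rfl
  | cons x w ih =>
    have part_top : insertionPart τ b (fun v => Φ (τ x :: v)) (w.length + 1) w = 0 := by
      simp [insertionPart]
    rw [insertion, ih, List.length_cons,
      Finset.sum_congr rfl fun s hs => insertionPart_cons τ b Φ (Finset.mem_Icc.1 hs).2 x,
      Finset.sum_add_distrib, add_comm,
      Finset.sum_Icc_succ_top (f := fun s => insertionPart τ b (fun v => Φ (τ x :: v)) s w)
        (Nat.le_add_left ..), part_top, add_zero]
    congr 1
    rw [deconcatSum, Finset.range_eq_Ico]
    exact Finset.sum_Ico_add' (fun s => Φ (b ((x :: w).take s) :: (x :: w).drop s)) 0 _ 1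

theorem insertionPart_length (w : List V) : insertionPart τ b Φ w.length w = Φ [b w] := by
  simp [insertionPart]

theorem insertionPart_of_length_eq_succ {w : List V} {n : ℕ} (hw : w.length = n + 1) :
    insertionPart τ b Φ n w = Φ (b (w.take n) :: w.drop n) +
      Φ ((w.take 1).map τ ++ [b (w.drop 1)]) := by
  rw [insertionPart, hw, show n + 1 + 1 - n = 2 by omega, Finset.sum_range_succ,
    Finset.sum_range_one, List.take_of_length_le (l := w.drop 1) (by simp [hw]),
    List.drop_of_length_le (i := 1 + n) (by omega), zero_add]
  simp

variable {b Φ} {s : ℕ} {w : List V}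

theorem insertionPart_eq_zero (h : ∀ v : List V, v.length + s = w.length + 1 → Φ v = 0) :
    insertionPart τ b Φ s w = 0 :=
  Finset.sum_eq_zero fun r hr => h _ (by
    rw [Finset.mem_range] at hr
    simp only [List.length_append, List.length_map, List.length_take, List.length_cons,
      List.length_drop]
    omega)

theorem insertionPart_eq_zero_of_corestriction {k V X : Type*} [CommSemiring k] [AddCommMonoid V]
    [Module k V] [AddCommMonoid X] [Module k X] (τ : V → V) {b : List V → V} {Φ : List V → X}
    {s : ℕ} {w : List V} (hb : ∀ v : List V, v.length = s → b v = 0) (hΦ : IsWordMultilinear k Φ) :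
    insertionPart τ b Φ s w = 0 :=
  Finset.sum_eq_zero fun r hr => by
    rw [Finset.mem_range] at hr
    rw [hb _ (by rw [List.length_take, List.length_drop]; omega)]
    exact (hΦ _ _).map_zero

end InsertionParts

section FirstOrder

variable {k V X : Type*} [CommSemiring k] [AddCommMonoid V] [Module k V] [AddCommMonoid X]
  [Module k X]

/-- The corestrictions of those morphisms of tensor coalgebras that differ from the identity by a
single component, of arity `p`. -/
structure IsElementary {V : Type*} [Zero V] (f : List V → V) (p : ℕ) : Prop where
  map_singleton : ∀ x, f [x] = x
  eq_zero : ∀ u : List V, u.length ≠ 1 → u.length ≠ p → f u = 0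

variable {f : List V → V} {p : ℕ} {Φ : List V → X} {w : List V}

theorem IsElementary.pullback_of_length_lt (hf : IsElementary f p) (hΦ : IsWordMultilinear k Φ)
    (hw : w.length < p) : pullback f Φ w = Φ w := by
  induction w generalizing Φ with
  | nil => rfl
  | cons x w ih =>
    rw [List.length_cons] at hw
    rw [pullback_cons, deconcatSum, Finset.sum_eq_single_of_mem 0 (by simp)]
    · simpa [hf.map_singleton] using ih (hΦ.cons x) (by omega)
    · intro i hi hi0
      rw [Finset.mem_range] at hi
      rw [hf.eq_zero (x :: w.take i) (by rw [List.length_cons, List.length_take]; omega)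
        (by rw [List.length_cons, List.length_take]; omega)]
      simp only [hΦ.zero_cons, pullback_zero]

theorem IsElementary.pullback_cons_of_le (hf : IsElementary f p) (hp : 2 ≤ p)
    (hΦ : IsWordMultilinear k Φ) (x : V) (hw : p ≤ w.length + 1) :
    pullback f Φ (x :: w) = pullback f (fun v => Φ (x :: v)) w +
      pullback f (fun v => Φ (f ((x :: w).take p) :: v)) ((x :: w).drop p) := by
  obtain ⟨p, rfl⟩ : ∃ q, p = q + 1 := ⟨p - 1, by omega⟩
  rw [pullback_cons, deconcatSum,
    Finset.sum_eq_add_of_mem 0 p (by simp) (by simp; omega) (by omega)]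
  · simp [hf.map_singleton]
  · rintro i hi ⟨hi0, hip⟩
    rw [Finset.mem_range] at hi
    rw [hf.eq_zero (x :: w.take i) (by rw [List.length_cons, List.length_take]; omega)
      (by rw [List.length_cons, List.length_take]; omega)]
    simp only [hΦ.zero_cons, pullback_zero]

theorem IsElementary.pullback_of_length_eq (hf : IsElementary f p) (hp : 2 ≤ p)
    (hΦ : IsWordMultilinear k Φ) (hw : w.length = p) : pullback f Φ w = Φ w + Φ [f w] := by
  cases w with
  | nil => simp at hw; omega
  | cons x w =>
    rw [hf.pullback_cons_of_le hp hΦ x hw.ge, List.take_of_length_le hw.le,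
      List.drop_of_length_le hw.le, pullback_nil,
      hf.pullback_of_length_lt (hΦ.cons x) (by rw [← hw]; simp)]

theorem IsElementary.pullback_of_length_eq_succ (hf : IsElementary f p) (hp : 2 ≤ p)
    (hΦ : IsWordMultilinear k Φ) (hw : w.length = p + 1) :
    pullback f Φ w = Φ w + Φ (w.take 1 ++ [f (w.drop 1)]) + Φ (f (w.take p) :: w.drop p) := by
  cases w with
  | nil => simp at hw
  | cons x w =>
    rw [List.length_cons, Nat.add_right_cancel_iff] at hw
    rw [hf.pullback_cons_of_le hp hΦ x (by omega), hf.pullback_of_length_eq hp (hΦ.cons x) hw,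
      hf.pullback_of_length_lt (hΦ.cons _) (by simp; omega)]
    simp

variable (τ : V → V) {b : List V → V}

theorem IsElementary.insertion_of_length_le (hf : IsElementary f p) (hfm : IsWordMultilinear k f)
    (hb0 : b [] = 0) (hb : ∀ x, b [x] = 0) (hw : w.length ≤ p) : insertion τ b f w = b w := by
  rcases w.length.eq_zero_or_pos with h0 | h0
  · rw [List.length_eq_zero_iff.1 h0, hb0]; rfl
  · rw [insertion_eq_sum_insertionPart, Finset.sum_eq_single_of_mem _ (Finset.right_mem_Icc.2 h0),
      insertionPart_length, hf.map_singleton]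
    intro s hs hsw
    rw [Finset.mem_Icc] at hs
    rcases hs.1.eq_or_lt with rfl | hs1
    · exact insertionPart_eq_zero_of_corestriction τ
        (fun v hv => by obtain ⟨x, rfl⟩ := List.length_eq_one_iff.1 hv; exact hb x) hfm
    · exact insertionPart_eq_zero τ fun v hv => hf.eq_zero v (by omega) (by omega)

theorem IsElementary.insertion_of_length_eq_succ (hf : IsElementary f p) (hp : 2 ≤ p)
    (hfm : IsWordMultilinear k f) (hb : ∀ x, b [x] = 0) (hw : w.length = p + 1) :
    insertion τ b f w = insertionPart τ b f 2 w + b w := by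
  rw [insertion_eq_sum_insertionPart, hw, Finset.sum_eq_add_of_mem 2 (p + 1) (by simp; omega)
    (by simp) (by omega), ← hw, insertionPart_length, hf.map_singleton]
  rintro s hs ⟨hs2, hsp⟩
  rw [Finset.mem_Icc] at hs
  rcases hs.1.eq_or_lt with rfl | _
  · exact insertionPart_eq_zero_of_corestriction τ
      (fun v hv => by obtain ⟨x, rfl⟩ := List.length_eq_one_iff.1 hv; exact hb x) hfm
  · exact insertionPart_eq_zero τ fun v hv => hf.eq_zero v (by omega) (by omega)

theorem insertion_self_of_length_eq_succ {n : ℕ} (hn : 3 ≤ n) (hbm : IsWordMultilinear k b)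
    (hb : ∀ x, b [x] = 0) (h : ∀ v : List V, 3 ≤ v.length → v.length < n → b v = 0)
    (hw : w.length = n + 1) :
    insertion τ b b w = insertionPart τ b b 2 w +
      (b (b (w.take n) :: w.drop n) + b ((w.take 1).map τ ++ [b (w.drop 1)])) := by
  rw [insertion_eq_sum_insertionPart, hw, Finset.sum_eq_add_of_mem 2 n (by simp; omega)
    (by simp; omega) (by omega), insertionPart_of_length_eq_succ τ b b hw]
  have hb1 : ∀ v : List V, v.length = 1 → b v = 0 := fun v hv => by
    obtain ⟨x, rfl⟩ := List.length_eq_one_iff.1 hv; exact hb x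
  rintro s hs ⟨hs2, hsn⟩
  rw [Finset.mem_Icc] at hs
  rcases hs.1.eq_or_lt with rfl | hs1
  · exact insertionPart_eq_zero_of_corestriction τ hb1 hbm
  rcases hs.2.lt_or_eq with hsn' | rfl
  · exact insertionPart_eq_zero_of_corestriction τ (fun v hv => h v (by omega) (by omega)) hbm
  · exact insertionPart_eq_zero τ fun v hv => hb1 v (by omega)

end FirstOrder

section ShiftedDegree

variable {k ι V W X : Type*} [CommSemiring k] [AddCommGroupWithOne ι]
  [AddCommMonoid V] [Module k V] [AddCommMonoid W] [Module k W] [AddCommMonoid X] [Module k X]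
  {𝒜 : ι → Submodule k V} {ℬ : ι → Submodule k W} {𝒳 : ι → Submodule k X}

/-- `w` consists of homogeneous letters, and `e` is its total degree when the degree of each letter
is lowered by one. -/
inductive HasShiftedDegree (𝒜 : ι → Submodule k V) : List V → ι → Prop
  | nil : HasShiftedDegree 𝒜 [] 0
  | cons {x : V} {d : ι} {w : List V} {e : ι} (hx : x ∈ 𝒜 d) (hw : HasShiftedDegree 𝒜 w e) :
      HasShiftedDegree 𝒜 (x :: w) (d - 1 + e)

theorem HasShiftedDegree.exists_degrees {w : List V} {e : ι} (hw : HasShiftedDegree 𝒜 w e) :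
    ∃ d : Fin w.length → ι, (∀ i : Fin w.length, w.getD i 0 ∈ 𝒜 (d i)) ∧ ∑ i, (d i - 1) = e := by
  induction hw with
  | nil => exact ⟨Fin.elim0, fun i => i.elim0, rfl⟩
  | @cons x d₀ w e hx _ ih =>
    obtain ⟨d, hd, rfl⟩ := ih
    exact ⟨Fin.cons d₀ d, Fin.cases hx hd, Fin.sum_univ_succ _⟩

theorem hasShiftedDegree_ofFn {n : ℕ} {a : Fin n → V} {d : Fin n → ι} (h : ∀ i, a i ∈ 𝒜 (d i)) :
    HasShiftedDegree 𝒜 (List.ofFn a) (∑ i, (d i - 1)) := by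
  induction n with
  | zero => exact .nil
  | succ n ih =>
    rw [List.ofFn_succ, Fin.sum_univ_succ]
    exact .cons (h 0) (ih fun i => h i.succ)

/-- `Φ` is homogeneous of degree `c`, when words have their shifted degree but values do not. So
degree `1` is that of morphisms and degree `2` that of differentials. -/
def IsShiftHomogeneous (𝒜 : ι → Submodule k V) (𝒳 : ι → Submodule k X) (Φ : List V → X) (c : ι) :
    Prop :=
  ∀ w e, HasShiftedDegree 𝒜 w e → Φ w ∈ 𝒳 (e + c)

namespace IsShiftHomogeneous

variable {Φ : List V → X} {c : ι}

theorem cons (h : IsShiftHomogeneous 𝒜 𝒳 Φ c) {y : V} {d : ι} (hy : y ∈ 𝒜 d) :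
    IsShiftHomogeneous 𝒜 𝒳 (fun w => Φ (y :: w)) (d - 1 + c) := fun w e hw => by
  convert h _ _ (.cons hy hw) using 2
  abel

theorem add {Ψ : List V → X} (hΦ : IsShiftHomogeneous 𝒜 𝒳 Φ c)
    (hΨ : IsShiftHomogeneous 𝒜 𝒳 Ψ c) : IsShiftHomogeneous 𝒜 𝒳 (fun w => Φ w + Ψ w) c :=
  fun w e hw => add_mem (hΦ w e hw) (hΨ w e hw)

theorem sub {k V X : Type*} [CommRing k] [AddCommMonoid V] [Module k V] [AddCommGroup X]
    [Module k X] {𝒜 : ι → Submodule k V} {𝒳 : ι → Submodule k X} {Φ Ψ : List V → X}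
    (hΦ : IsShiftHomogeneous 𝒜 𝒳 Φ c) (hΨ : IsShiftHomogeneous 𝒜 𝒳 Ψ c) :
    IsShiftHomogeneous 𝒜 𝒳 (fun w => Φ w - Ψ w) c :=
  fun w e hw => sub_mem (hΦ w e hw) (hΨ w e hw)

theorem pullbackAux {f g : List V → W} (hf : IsShiftHomogeneous 𝒜 ℬ f 1) {d : ι}
    (hg : IsShiftHomogeneous 𝒜 ℬ g d) {Φ : List W → X} (hΦ : IsShiftHomogeneous ℬ 𝒳 Φ c) :
    IsShiftHomogeneous 𝒜 𝒳 (pullbackAux f g Φ) (d - 1 + c) := by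
  intro w e hw
  have hg₀ : g [] ∈ ℬ d := zero_add d ▸ hg [] 0 .nil
  induction hw generalizing g d Φ c with
  | nil => exact hΦ.cons hg₀ [] 0 .nil
  | @cons x d₀ w e hx _ ih =>
    refine add_mem ?_ ?_
    · convert ih (hg.cons hx) hΦ (zero_add (d₀ - 1 + d) ▸ hg.cons hx [] 0 .nil) using 2
      abel
    · convert ih (hf.cons hx) (hΦ.cons hg₀) (zero_add (d₀ - 1 + 1) ▸ hf.cons hx [] 0 .nil) using 2
      abel

theorem pullback {f : List V → W} (hf : IsShiftHomogeneous 𝒜 ℬ f 1) {Φ : List W → X}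
    (hΦ : IsShiftHomogeneous ℬ 𝒳 Φ c) : IsShiftHomogeneous 𝒜 𝒳 (pullback f Φ) c := by
  rintro w e (_ | ⟨hx, hw⟩)
  · exact hΦ [] 0 .nil
  · rw [AInf.pullback]
    convert hf.pullbackAux (hf.cons hx) hΦ _ _ hw using 2
    abel

theorem deconcatSum {H : List V → List V → X}
    (h : ∀ u e v e', HasShiftedDegree 𝒜 u e → HasShiftedDegree 𝒜 v e' → H u v ∈ 𝒳 (e + e' + c)) :
    IsShiftHomogeneous 𝒜 𝒳 (deconcatSum H) c := by
  intro w e hw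
  induction hw generalizing H c with
  | nil => rw [deconcatSum_nil]; simpa only [add_zero] using h [] 0 [] 0 .nil .nil
  | @cons x d w e hx hw ih =>
    rw [deconcatSum_cons]
    refine add_mem ?_ ?_
    · simpa only [zero_add] using h [] 0 _ _ .nil (.cons hx hw)
    · convert ih (c := d - 1 + c) fun u e v e' hu hv => ?_ using 2
      · abel
      · convert h _ _ _ _ (.cons hx hu) hv using 2
        abel

theorem insertion {τ : V → V} (hτ : ∀ d, ∀ x ∈ 𝒜 d, τ x ∈ 𝒜 d) {b : List V → V} {c' : ι}
    (hb : IsShiftHomogeneous 𝒜 𝒜 b c') (hΦ : IsShiftHomogeneous 𝒜 𝒳 Φ c) :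
    IsShiftHomogeneous 𝒜 𝒳 (insertion τ b Φ) (c' - 1 + c) := by
  intro w e hw
  induction hw generalizing Φ c with
  | nil => exact zero_mem _
  | @cons x d w e hx hw ih =>
    refine add_mem ?_ ?_
    · convert ih (hΦ.cons (hτ d x hx)) using 2
      abel
    · convert deconcatSum (c := d - 1 + (c' - 1 + c)) (fun u e v e' hu hv => ?_) w e hw using 2
      · abel
      · convert hΦ.cons (hb _ _ (.cons hx hu)) _ _ hv using 2
        abel

theorem letter : IsShiftHomogeneous 𝒜 𝒜 (letter : List V → V) 1 := by
  rintro w e (_ | ⟨hx, _ | ⟨_, _⟩⟩)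
  · exact zero_mem _
  · simpa [letter_singleton] using hx
  · exact zero_mem _

theorem substInv {k V : Type*} [CommRing k] [AddCommGroup V] [Module k V]
    {𝒜 : ι → Submodule k V} {f : List V → V} (hf : IsShiftHomogeneous 𝒜 𝒜 f 1) :
    IsShiftHomogeneous 𝒜 𝒜 (substInv f) 1 := by
  have approx : ∀ n, IsShiftHomogeneous 𝒜 𝒜 (substInvApprox f n) 1 := fun n => by
    induction n with
    | zero => exact letter
    | succ n ih => exact ih.add (letter.sub (hf.pullback ih))
  exact fun w => approx w.length w

end IsShiftHomogeneous

end ShiftedDegree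

section Koszul

variable {k : Type*} [Field k] {N : ℕ} {V W : Type*} [AddCommGroup V] [Module k V]
  [AddCommGroup W] [Module k W]

theorem even_val_intCast (hN : Even N) (z : ℤ) : Even (z : ZMod N).val ↔ Even z := by
  rcases N.eq_zero_or_pos with rfl | h
  · exact Int.natAbs_even
  · have : NeZero N := ⟨h.ne'⟩
    rw [← Int.even_coe_nat, ZMod.val_intCast, Int.even_iff, Int.even_iff,
      Int.emod_emod_of_dvd _ (by exact_mod_cast hN.two_dvd)]

theorem even_val_add (hN : Even N) (a b : ZMod N) :
    Even (a + b).val ↔ (Even a.val ↔ Even b.val) := by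
  obtain ⟨a, rfl⟩ := ZMod.intCast_surjective a
  obtain ⟨b, rfl⟩ := ZMod.intCast_surjective b
  rw [← Int.cast_add]
  simp only [even_val_intCast hN, Int.even_add]

theorem even_val_sub_one (hN : Even N) (a : ZMod N) : Even (a - 1).val ↔ ¬Even a.val := by
  obtain ⟨a, rfl⟩ := ZMod.intCast_surjective a
  rw [← Int.cast_one, ← Int.cast_sub]
  simp only [even_val_intCast hN, Int.even_sub, Int.not_even_one, iff_false]

variable (𝒜 : ZMod N → Submodule k V) [DirectSum.Decomposition 𝒜]
  (ℬ : ZMod N → Submodule k W) [DirectSum.Decomposition ℬ]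

variable {𝒜} in
theorem linearMap_ext_homogeneous {L L' : V →ₗ[k] W} (h : ∀ d, ∀ x ∈ 𝒜 d, L x = L' x) :
    L = L' := by
  ext x
  induction x using DirectSum.Decomposition.inductionOn 𝒜 with
  | zero => simp
  | homogeneous x => exact h _ _ x.2
  | add x y hx hy => simp [hx, hy]

theorem koszul_koszul (p q : ℤ) (x : V) : koszul 𝒜 p (koszul 𝒜 q x) = koszul 𝒜 (p + q) x := by
  suffices h : koszul 𝒜 p ∘ₗ koszul 𝒜 q = koszul 𝒜 (p + q) from LinearMap.congr_fun h x
  refine linearMap_ext_homogeneous (𝒜 := 𝒜) fun d x hx => ?_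
  rw [LinearMap.comp_apply, koszul_of_mem 𝒜 q hx, map_smul, koszul_of_mem 𝒜 p hx,
    koszul_of_mem 𝒜 _ hx, smul_smul, ← pow_add]
  congr 1
  refine neg_one_pow_congr ?_
  simp only [← add_mul, Nat.even_mul, Nat.even_add, Int.natAbs_even, Int.even_add]
  tauto

theorem koszul_congr {p q : ℤ} (h : Even p ↔ Even q) : koszul 𝒜 p = koszul 𝒜 q := by
  refine linearMap_ext_homogeneous (𝒜 := 𝒜) fun d x hx => ?_
  rw [koszul_of_mem 𝒜 q hx, koszul_of_mem 𝒜 p hx]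
  congr 1
  refine neg_one_pow_congr ?_
  simp only [Nat.even_mul, Int.natAbs_even, h]

theorem koszul_of_even {p : ℤ} (h : Even p) (x : V) : koszul 𝒜 p x = x := by
  suffices h : koszul 𝒜 p = LinearMap.id from LinearMap.congr_fun h x
  refine linearMap_ext_homogeneous (𝒜 := 𝒜) fun d x hx => ?_
  rw [koszul_of_mem 𝒜 p hx, ((Int.natAbs_even.2 h).mul_right _).neg_one_pow, one_smul,
    LinearMap.id_apply]

theorem koszul_koszul_self (p : ℤ) (x : V) : koszul 𝒜 p (koszul 𝒜 p x) = x := by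
  rw [koszul_koszul, koszul_of_even 𝒜 (Even.add_self p)]

variable {𝒜} in
theorem koszul_mem (p : ℤ) {d : ZMod N} {x : V} (hx : x ∈ 𝒜 d) : koszul 𝒜 p x ∈ 𝒜 d := by
  rw [koszul_of_mem 𝒜 p hx]
  exact Submodule.smul_mem _ _ hx

theorem IsWordMultilinear.ext_homogeneous {Φ Ψ : List V → W} (hΦ : IsWordMultilinear k Φ)
    (hΨ : IsWordMultilinear k Ψ) (h : ∀ w e, HasShiftedDegree 𝒜 w e → Φ w = Ψ w) (w : List V) :
    Φ w = Ψ w := by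
  induction w generalizing Φ Ψ with
  | nil => exact h [] 0 .nil
  | cons x w ih =>
    refine LinearMap.congr_fun (f := (hΦ.head w).mk' _) (g := (hΨ.head w).mk' _)
      (linearMap_ext_homogeneous (𝒜 := 𝒜) fun d y hy => ?_) x
    exact ih (hΦ.cons y) (hΨ.cons y) fun v e hv => h (y :: v) _ (.cons hy hv)

theorem IsWordMultilinear.map_smul_append {k V W : Type*} [CommSemiring k] [AddCommMonoid V]
    [Module k V] [AddCommMonoid W] [Module k W] {Φ : List V → W} (h : IsWordMultilinear k Φ)
    (c : k) (u v : List V) : Φ (u.map (c • ·) ++ v) = c ^ u.length • Φ (u ++ v) := by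
  induction u generalizing Φ with
  | nil => simp
  | cons x u ih =>
    rw [List.map_cons, List.cons_append, (h.head _).map_smul, ih (h.cons x), smul_smul,
      List.length_cons, pow_succ', List.cons_append]

theorem IsWordMultilinear.map_linearMap {k V V' W : Type*} [CommSemiring k] [AddCommMonoid V]
    [Module k V] [AddCommMonoid V'] [Module k V'] [AddCommMonoid W] [Module k W] {Φ : List V → W}
    (h : IsWordMultilinear k Φ) (L : V' →ₗ[k] V) : IsWordMultilinear k (fun w => Φ (w.map L)) := by
  intro u v
  simp only [List.map_append, List.map_cons]
  exact isLinearMap_comp (Ψ := L) (h _ _) L.isLinear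

/-- The operator `x ↦ (-1)^{q (|x| - 1)} x`: the Koszul sign for moving a map of degree `q` past `x`
when the grading is shifted by one. -/
noncomputable def shiftedKoszul (q : ℤ) : V →ₗ[k] V := (-1 : k) ^ q.natAbs • koszul 𝒜 q

variable {𝒜}

theorem shiftedKoszul_apply (q : ℤ) (x : V) :
    shiftedKoszul 𝒜 q x = (-1 : k) ^ q.natAbs • koszul 𝒜 q x := rfl

theorem shiftedKoszul_of_mem (hN : Even N) (q : ℤ) {d : ZMod N} {x : V} (hx : x ∈ 𝒜 d) :
    shiftedKoszul 𝒜 q x = ((-1 : k) ^ (q.natAbs * (d - 1).val)) • x := by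
  rw [shiftedKoszul_apply, koszul_of_mem 𝒜 q hx, smul_smul, ← pow_add]
  congr 1
  refine neg_one_pow_congr ?_
  simp only [Nat.even_mul, Nat.even_add, even_val_sub_one hN]
  tauto

theorem shiftedKoszul_mem (q : ℤ) (d : ZMod N) (x : V) (hx : x ∈ 𝒜 d) :
    shiftedKoszul 𝒜 q x ∈ 𝒜 d :=
  Submodule.smul_mem _ _ (koszul_mem q hx)

theorem HasShiftedDegree.map_shiftedKoszul (hN : Even N) {w : List V} {e : ZMod N}
    (hw : HasShiftedDegree 𝒜 w e) {Φ : List V → W} (hΦ : IsWordMultilinear k Φ) (q : ℤ) :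
    Φ (w.map (shiftedKoszul 𝒜 q)) = ((-1 : k) ^ (q.natAbs * e.val)) • Φ w := by
  induction hw generalizing Φ with
  | nil => simp
  | @cons x d w e hx _ ih =>
    rw [List.map_cons, shiftedKoszul_of_mem hN q hx, (hΦ.head _).map_smul, ih (hΦ.cons x),
      smul_smul, ← pow_add, ← mul_add]
    congr 1
    refine neg_one_pow_congr ?_
    simp only [Nat.even_mul, Nat.even_add, even_val_add hN]

variable {ℬ} {Φ : List V → W}

theorem IsShiftHomogeneous.koszul_apply (hN : Even N) {c : ZMod N}
    (hΦ : IsShiftHomogeneous 𝒜 ℬ Φ c) (hm : IsWordMultilinear k Φ) (q : ℤ) (w : List V) :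
    koszul ℬ q (Φ w) =
      ((-1 : k) ^ (q.natAbs * c.val)) • Φ (w.map (shiftedKoszul 𝒜 q)) := by
  have left_multilinear : IsWordMultilinear k (fun w => koszul ℬ q (Φ w)) := fun u v =>
    isLinearMap_comp (koszul ℬ q).isLinear (hm u v)
  refine left_multilinear.ext_homogeneous 𝒜 ((hm.map_linearMap _).smul _) (fun w e hw => ?_) w
  rw [koszul_of_mem ℬ q (hΦ w e hw), hw.map_shiftedKoszul hN hm, smul_smul, ← pow_add, ← mul_add]
  congr 1
  refine neg_one_pow_congr ?_
  simp only [Nat.even_mul, Nat.even_add, even_val_add hN]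
  tauto

theorem IsShiftHomogeneous.map_shiftedKoszul_one (hN : Even N)
    (hΦ : IsShiftHomogeneous 𝒜 ℬ Φ 1) (hm : IsWordMultilinear k Φ) (w : List V) :
    Φ (w.map (shiftedKoszul 𝒜 1)) = shiftedKoszul ℬ 1 (Φ w) := by
  have odd_val : Odd (1 : ZMod N).val := by
    simpa [← Nat.not_even_iff_odd] using even_val_intCast hN 1
  rw [shiftedKoszul_apply (𝒜 := ℬ), hΦ.koszul_apply hN hm]
  simp [odd_val.neg_one_pow]

theorem IsShiftHomogeneous.map_shiftedKoszul_two (hN : Even N)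
    (hΦ : IsShiftHomogeneous 𝒜 ℬ Φ 2) (hm : IsWordMultilinear k Φ) (w : List V) :
    Φ (w.map (shiftedKoszul 𝒜 1)) = -shiftedKoszul ℬ 1 (Φ w) := by
  have even_val : Even (2 : ZMod N).val := by simpa using even_val_intCast hN 2
  rw [shiftedKoszul_apply (𝒜 := ℬ), hΦ.koszul_apply hN hm]
  simp [even_val.neg_one_pow]

end Koszul

section BarConstruction

variable {k : Type*} [Field k] {N : ℕ} {V W X : Type*} [AddCommGroup V] [Module k V]
  [AddCommGroup W] [Module k W] [AddCommGroup X] [Module k X]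
  (𝒜 : ZMod N → Submodule k V) [DirectSum.Decomposition 𝒜]
  (ℬ : ZMod N → Submodule k W) [DirectSum.Decomposition ℬ]
  (𝒞 : ZMod N → Submodule k X)

/-- `b` is the corestriction of a square-zero coderivation of degree one of the tensor coalgebra of
the shift of `𝒜`. -/
structure IsBarDifferential (b : List V → V) : Prop where
  multilinear : IsWordMultilinear k b
  homogeneous : IsShiftHomogeneous 𝒜 𝒜 b 2
  map_nil : b [] = 0
  insertion_self : ∀ w, insertion (shiftedKoszul 𝒜 1) b b w = 0

/-- `f` is the corestriction of a morphism of degree zero between the tensor coalgebras of the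
shifts of `𝒜` and `ℬ`, compatible with the coderivations with corestrictions `b` and `b'`. -/
structure IsBarMorphism (b : List V → V) (b' : List W → W) (f : List V → W) : Prop where
  multilinear : IsWordMultilinear k f
  homogeneous : IsShiftHomogeneous 𝒜 ℬ f 1
  map_nil : f [] = 0
  pullback_eq : ∀ w, pullback f b' w = insertion (shiftedKoszul 𝒜 1) b f w

variable {𝒜 ℬ 𝒞} {b : List V → V} {b' : List W → W} {f : List V → W}

theorem IsBarMorphism.letter (hb : IsBarDifferential 𝒜 b) : IsBarMorphism 𝒜 𝒜 b b letter where
  multilinear := .letter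
  homogeneous := .letter
  map_nil := letter_nil
  pullback_eq w := by rw [pullback_letter_left hb.multilinear, insertion_letter _ hb.map_nil]

theorem IsBarMorphism.insertion_pullback (hN : Even N) (hf : IsBarMorphism 𝒜 ℬ b b' f)
    (hb' : b' [] = 0) {Φ : List W → X} (hΦ : IsWordMultilinear k Φ) (w : List V) :
    insertion (shiftedKoszul 𝒜 1) b (pullback f Φ) w =
      pullback f (insertion (shiftedKoszul ℬ 1) b' Φ) w :=
  AInf.insertion_pullback hb' hf.map_nil (hf.homogeneous.map_shiftedKoszul_one hN hf.multilinear)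
    hf.pullback_eq hΦ w

theorem IsBarMorphism.pullback (hN : Even N) {c : List X → X} {g : List W → X}
    (hf : IsBarMorphism 𝒜 ℬ b b' f) (hg : IsBarMorphism ℬ 𝒞 b' c g) (hb' : b' [] = 0)
    (hc : IsWordMultilinear k c) : IsBarMorphism 𝒜 𝒞 b c (pullback f g) where
  multilinear := hf.multilinear.pullback hg.multilinear
  homogeneous := hf.homogeneous.pullback hg.homogeneous
  map_nil := hg.map_nil
  pullback_eq w := by
    rw [← pullback_pullback f hg.map_nil hc, funext hg.pullback_eq,
      hf.insertion_pullback hN hb' hg.multilinear]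

/-- The coderivation with corestriction `b`, conjugated by the coalgebra automorphism with unipotent
corestriction `f`. -/
noncomputable def barTransport (𝒜 : ZMod N → Submodule k V) [DirectSum.Decomposition 𝒜]
    (b f : List V → V) : List V → V :=
  pullback (substInv f) (insertion (shiftedKoszul 𝒜 1) b f)

namespace IsUnipotent

variable {f : List V → V}

theorem isBarMorphism_barTransport (hf : IsUnipotent k f) (hfh : IsShiftHomogeneous 𝒜 𝒜 f 1)
    (hb : IsWordMultilinear k b) : IsBarMorphism 𝒜 𝒜 b (barTransport 𝒜 b f) f where
  multilinear := hf.multilinear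
  homogeneous := hfh
  map_nil := hf.map_nil
  pullback_eq :=
    hf.pullback_substInv_cancel (hb.insertion (shiftedKoszul 𝒜 1).isLinear hf.multilinear)

theorem isBarDifferential_barTransport (hN : Even N) (hf : IsUnipotent k f)
    (hfh : IsShiftHomogeneous 𝒜 𝒜 f 1) (hb : IsBarDifferential 𝒜 b) :
    IsBarDifferential 𝒜 (barTransport 𝒜 b f) := by
  have multilinear : IsWordMultilinear k (barTransport 𝒜 b f) :=
    hf.substInv.multilinear.pullback
      (hb.multilinear.insertion (shiftedKoszul 𝒜 1).isLinear hf.multilinear)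
  refine ⟨multilinear, ?_, rfl, fun w => ?_⟩
  · rw [show (2 : ZMod N) = 2 - 1 + 1 by ring]
    exact hfh.substInv.pullback (.insertion (shiftedKoszul_mem 1) hb.homogeneous hfh)
  · have morphism := hf.isBarMorphism_barTransport hfh hb.multilinear
    have square_eq_zero : pullback f
        (insertion (shiftedKoszul 𝒜 1) (barTransport 𝒜 b f) (barTransport 𝒜 b f)) = 0 := by
      funext v
      rw [← morphism.insertion_pullback hN rfl multilinear, funext morphism.pullback_eq]
      exact insertion_insertion hb.map_nil
        (hb.homogeneous.map_shiftedKoszul_two hN hb.multilinear) hb.insertion_self hf.multilinear v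
    rw [← hf.substInv_pullback_cancel
      (multilinear.insertion (shiftedKoszul 𝒜 1).isLinear multilinear), square_eq_zero]
    exact pullback_zero ..

theorem isBarMorphism_substInv (hN : Even N) (hf : IsUnipotent k f) {b' : List V → V}
    (hfb : IsBarMorphism 𝒜 𝒜 b b' f) (hb : b [] = 0) (hb' : IsWordMultilinear k b')
    (hb'_nil : b' [] = 0) : IsBarMorphism 𝒜 𝒜 b' b (AInf.substInv f) where
  multilinear := hf.substInv.multilinear
  homogeneous := hfb.homogeneous.substInv
  map_nil := hf.substInv.map_nil
  pullback_eq w := by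
    have inverse := hf.substInv.multilinear
    rw [← hf.substInv_pullback_cancel (hb'.insertion (shiftedKoszul 𝒜 1).isLinear inverse),
      ← funext (hfb.insertion_pullback hN hb'_nil inverse), funext hf.pullback_substInv,
      funext (insertion_letter _ hb)]

end IsUnipotent

end BarConstruction

section BarShift

variable {k : Type*} [Field k] {N : ℕ} {V W X : Type*} [AddCommGroup V] [Module k V]
  [AddCommGroup W] [Module k W] [AddCommGroup X] [Module k X]

theorem ofFn_update {V : Type*} {n : ℕ} [DecidableEq (Fin n)] (a : Fin n → V) (i : Fin n) (x : V) :
    List.ofFn (Function.update a i x) =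
      (List.ofFn a).take i ++ x :: (List.ofFn a).drop (i + 1) := by
  have set_eq := List.set_eq_take_append_cons_drop (l := List.ofFn a) (i := i) (a := x)
  rw [if_pos (by simp)] at set_eq
  rw [← set_eq]
  refine List.ext_getElem (by simp) fun j _ _ => ?_
  simp only [List.getElem_ofFn, List.getElem_set, Function.update_apply, Fin.ext_iff, eq_comm]

theorem ofFn_getD {V : Type*} [Zero V] (w : List V) :
    List.ofFn (fun i : Fin w.length => w.getD i 0) = w :=
  List.ext_getElem (by simp) fun i _ _ => by simp

theorem getD_append_cons {V : Type*} [Zero V] (u v : List V) (x : V) (i : ℕ) :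
    (u ++ x :: v).getD i 0 = if i = u.length then x else (u ++ 0 :: v).getD i 0 := by
  grind

theorem neg_one_pow_mul_self {R : Type*} [CommRing R] (n : ℕ) : (-1 : R) ^ n * (-1) ^ n = 1 := by
  rw [← mul_pow, neg_mul_neg, one_mul, one_pow]

theorem exists_seq {V : Type*} [Zero V] {n : ℕ} (a : Fin n → V) :
    ∃ b : ℕ → V, a = fun i : Fin n => b i :=
  ⟨fun i => if h : i < n then a ⟨i, h⟩ else 0, by funext i; simp⟩

/-- The component of arity `n` of a multilinear function on words. -/
def multilinearOfWord (Φ : List V → X) (h : IsWordMultilinear k Φ) (n : ℕ) :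
    MultilinearMap k (fun _ : Fin n => V) X where
  toFun a := Φ (List.ofFn a)
  map_update_add' a i x y := by simp only [ofFn_update, (h _ _).map_add]
  map_update_smul' a i c x := by simp only [ofFn_update, (h _ _).map_smul]

variable (𝒜 : ZMod N → Submodule k V) [DirectSum.Decomposition 𝒜]
  {ℬ : ZMod N → Submodule k W}

/-- The function on words given by a family of multilinear maps once all degrees are lowered by one.
Its signs are the Koszul signs of the `n`-th tensor power of the shift, and they absorb those of the
`A∞`-relations. -/
noncomputable def barShift (f : ∀ n : ℕ, MultilinearMap k (fun _ : Fin n => V) X) (w : List V) :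
    X :=
  ((-1 : k) ^ w.length.choose 2) •
    f w.length (fun i => koszul 𝒜 ((w.length : ℤ) - 1 - i) (w.getD i 0))

/-- The family of multilinear maps with a given `barShift`. -/
noncomputable def barUnshift (Φ : List V → X) (h : IsWordMultilinear k Φ) (n : ℕ) :
    MultilinearMap k (fun _ : Fin n => V) X :=
  ((-1 : k) ^ n.choose 2) •
    (multilinearOfWord Φ h n).compLinearMap (fun i => koszul 𝒜 ((n : ℤ) - 1 - i))

/-- The word of length `n` at which `barShift 𝒜 f` takes the value `f a₁ … aₙ`, up to sign. -/
noncomputable def signedWord (n : ℕ) (a : ℕ → V) : List V :=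
  List.ofFn (fun i : Fin n => koszul 𝒜 ((n : ℤ) - 1 - i) (a i))

theorem length_signedWord (n : ℕ) (a : ℕ → V) : (signedWord 𝒜 n a).length = n := by
  simp [signedWord]

theorem getD_signedWord {n : ℕ} (a : ℕ → V) {i : ℕ} (hi : i < n) :
    (signedWord 𝒜 n a).getD i 0 = koszul 𝒜 ((n : ℤ) - 1 - i) (a i) := by
  simp [signedWord, hi]

theorem exists_signedWord (w : List V) : ∃ a : ℕ → V, w = signedWord 𝒜 w.length a := by
  refine ⟨fun i => koszul 𝒜 ((w.length : ℤ) - 1 - i) (w.getD i 0), ?_⟩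
  simp only [signedWord, koszul_koszul_self]
  exact (ofFn_getD w).symm

variable (f g : ∀ n : ℕ, MultilinearMap k (fun _ : Fin n => V) X)

theorem barShift_of_length {w : List V} {n : ℕ} (h : w.length = n) : barShift 𝒜 f w =
    ((-1 : k) ^ n.choose 2) • f n (fun i => koszul 𝒜 ((n : ℤ) - 1 - i) (w.getD i 0)) := by
  subst h; rfl

theorem isWordMultilinear_barShift : IsWordMultilinear k (barShift 𝒜 f) := by
  intro u v
  set n := u.length + (v.length + 1)
  let j : Fin n := ⟨u.length, by omega⟩
  have letters : ∀ x,
      (fun i : Fin n => koszul 𝒜 ((n : ℤ) - 1 - i) ((u ++ x :: v).getD i 0)) =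
        Function.update (fun i : Fin n => koszul 𝒜 ((n : ℤ) - 1 - i) ((u ++ 0 :: v).getD i 0)) j
          (koszul 𝒜 ((n : ℤ) - 1 - j) x) := fun x => by
    funext i
    rw [getD_append_cons, Function.update_apply]
    by_cases hi : i = j
    · simp [hi, j]
    · rw [if_neg hi, if_neg fun h => hi (Fin.ext h)]
  have value : ∀ x, barShift 𝒜 f (u ++ x :: v) = _ := fun x => by
    rw [barShift_of_length 𝒜 f (n := n) (by simp [n]), letters]
  simp only [value]
  exact (((-1 : k) ^ n.choose 2) • ((f n).toLinearMap _ j ∘ₗ koszul 𝒜 _)).isLinear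

theorem barShift_barUnshift {Φ : List V → X} (h : IsWordMultilinear k Φ) :
    barShift 𝒜 (barUnshift 𝒜 Φ h) = Φ := by
  funext w
  simp only [barShift, barUnshift, _root_.smul_apply, MultilinearMap.compLinearMap_apply, smul_smul,
    neg_one_pow_mul_self, one_smul, koszul_koszul_self]
  exact congrArg Φ (ofFn_getD w)

theorem barShift_signedWord (n : ℕ) (a : ℕ → V) :
    barShift 𝒜 f (signedWord 𝒜 n a) = ((-1 : k) ^ n.choose 2) • f n (fun i => a i) := by
  rw [barShift_of_length 𝒜 f (length_signedWord 𝒜 n a)]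
  congr 2
  funext i
  rw [getD_signedWord 𝒜 a i.2, koszul_koszul_self]

theorem apply_eq_barShift (n : ℕ) (a : ℕ → V) :
    f n (fun i => a i) = ((-1 : k) ^ n.choose 2) • barShift 𝒜 f (signedWord 𝒜 n a) := by
  rw [barShift_signedWord, smul_smul, neg_one_pow_mul_self, one_smul]

variable {f g}

theorem barShift_congr {w : List V} (h : f w.length = g w.length) :
    barShift 𝒜 f w = barShift 𝒜 g w := by
  rw [barShift, barShift, h]

theorem barShift_eq_zero {w : List V} (h : f w.length = 0) : barShift 𝒜 f w = 0 := by
  rw [barShift, h, _root_.zero_apply, smul_zero]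

theorem multilinear_eq_of_barShift_eq {n : ℕ}
    (h : ∀ w : List V, w.length = n → barShift 𝒜 f w = barShift 𝒜 g w) : f n = g n := by
  ext a
  obtain ⟨b, rfl⟩ := exists_seq a
  rw [apply_eq_barShift 𝒜 f, apply_eq_barShift 𝒜 g, h _ (length_signedWord 𝒜 n b)]

theorem multilinear_eq_zero_of_barShift {n : ℕ}
    (h : ∀ w : List V, w.length = n → barShift 𝒜 f w = 0) : f n = 0 :=
  multilinear_eq_of_barShift_eq 𝒜 (g := fun _ => 0) fun w hw => by
    rw [h w hw, barShift_eq_zero 𝒜 rfl]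

theorem barShift_idMaps : barShift 𝒜 (idMaps k V) = letter := by
  funext w
  match w with
  | [] => exact barShift_eq_zero 𝒜 rfl
  | [x] =>
    rw [barShift_of_length 𝒜 _ (n := 1) rfl]
    simp [idMaps, letter_singleton, koszul_of_even]
  | x :: y :: w => exact barShift_eq_zero 𝒜 rfl

variable {𝒜}

theorem isShiftHomogeneous_barShift {f : ∀ n : ℕ, MultilinearMap k (fun _ : Fin n => V) W} {c : ℤ}
    (h : ∀ n : ℕ, IsHomogeneous 𝒜 ℬ (f n) (c - n)) :
    IsShiftHomogeneous 𝒜 ℬ (barShift 𝒜 f) c := by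
  intro w e hw
  obtain ⟨d, hd, rfl⟩ := hw.exists_degrees
  refine Submodule.smul_mem _ _ ?_
  convert h w.length d _ fun i => koszul_mem ((w.length : ℤ) - 1 - i) (hd i) using 2
  simp [Finset.sum_sub_distrib, sub_add_eq_add_sub, add_sub_assoc]

theorem isHomogeneous_barUnshift {Φ : List V → W} {c : ℤ} (h : IsWordMultilinear k Φ)
    (hΦ : IsShiftHomogeneous 𝒜 ℬ Φ c) (n : ℕ) :
    IsHomogeneous 𝒜 ℬ (barUnshift 𝒜 Φ h n) (c - n) := by
  intro d a ha
  refine Submodule.smul_mem _ _ ?_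
  change Φ (List.ofFn fun i : Fin n => koszul 𝒜 ((n : ℤ) - 1 - i) (a i)) ∈ _
  convert hΦ _ _ (hasShiftedDegree_ofFn fun i => koszul_mem ((n : ℤ) - 1 - i) (ha i)) using 2
  simp [Finset.sum_sub_distrib, sub_add_eq_add_sub, add_sub_assoc]

end BarShift

section Compositions

theorem choose_two_add (a b : ℕ) : (a + b).choose 2 = a.choose 2 + b.choose 2 + a * b := by
  induction b with
  | zero => simp
  | succ b ih =>
    rw [← add_assoc, Nat.choose_succ_succ' (a + b) 1, Nat.choose_succ_succ' b 1, ih,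
      Nat.choose_one_right, Nat.choose_one_right]
    ring

theorem choose_two_sum (u : ℕ → ℕ) (l : ℕ) :
    (∑ j ∈ Finset.range l, (u j + 1)).choose 2 =
      l.choose 2 + (∑ j ∈ Finset.range l, ((u j + 1).choose 2 + (l - 1 - j) * u j)) +
        ∑ j ∈ Finset.range l, u j * ∑ i ∈ Finset.range j, (u i + 1) := by
  induction l with
  | zero => simp
  | succ l ih =>
    have shift_weights : ∑ j ∈ Finset.range l, ((u j + 1).choose 2 + (l + 1 - 1 - j) * u j) =
        (∑ j ∈ Finset.range l, ((u j + 1).choose 2 + (l - 1 - j) * u j)) +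
          ∑ j ∈ Finset.range l, u j := by
      rw [← Finset.sum_add_distrib]
      refine Finset.sum_congr rfl fun j hj => ?_
      rw [Finset.mem_range] at hj
      rw [show l + 1 - 1 - j = (l - 1 - j) + 1 by omega]
      ring
    have sum_succ : ∑ j ∈ Finset.range l, (u j + 1) = (∑ j ∈ Finset.range l, u j) + l := by
      simp [Finset.sum_add_distrib]
    rw [Finset.sum_range_succ, Finset.sum_range_succ, Finset.sum_range_succ, choose_two_add, ih,
      shift_weights, choose_two_add l 1, sum_succ, Nat.add_sub_cancel, Nat.sub_self]
    simp only [Nat.choose_eq_zero_of_lt one_lt_two]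
    ring

theorem sum_composition_succ {X : Type*} [AddCommMonoid X] (F : List ℕ → X) (n : ℕ) :
    ∑ c : Composition (n + 1), F c.blocks =
      ∑ i ∈ Finset.range (n + 1), ∑ c : Composition (n - i), F ((i + 1) :: c.blocks) := by
  rw [Finset.sum_sigma']
  symm
  refine Finset.sum_bij
    (i := fun (p : Σ i, Composition (n - i)) hp =>
      (⟨(p.1 + 1) :: p.2.blocks, by
          intro i hi
          rcases List.mem_cons.1 hi with rfl | hi
          · omega
          · exact p.2.blocks_pos hi, by
          have : p.1 < n + 1 := by simpa using hp
          rw [List.sum_cons, p.2.blocks_sum]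
          omega⟩ : Composition (n + 1)))
    (fun _ _ => Finset.mem_univ _) ?_ ?_ (fun _ _ => rfl)
  · rintro ⟨i, c⟩ _ ⟨j, d⟩ _ h
    have blocks_eq := congrArg Composition.blocks h
    simp only [List.cons.injEq, Nat.add_right_cancel_iff] at blocks_eq
    obtain ⟨rfl, blocks_eq⟩ := blocks_eq
    rw [Composition.ext blocks_eq]
  · rintro ⟨_ | ⟨b, bs⟩, hpos, hsum⟩ _
    · simp at hsum
    · have hb := hpos List.mem_cons_self
      rw [List.sum_cons] at hsum
      refine ⟨⟨b - 1, ⟨bs, fun hi => hpos (List.mem_cons_of_mem _ hi), by omega⟩⟩, ?_, ?_⟩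
      · simp
        omega
      · ext1
        simp only [List.cons.injEq, and_true]
        omega

theorem pullback_eq_sum_composition {V W X : Type*} [AddCommMonoid X] (f : List V → W)
    (Φ : List W → X) {n : ℕ} {w : List V} (hw : w.length = n) :
    pullback f Φ w = ∑ c : Composition n, Φ ((w.splitWrtComposition c).map f) := by
  induction n using Nat.strong_induction_on generalizing Φ w with
  | _ n ih =>
  cases w with
  | nil =>
    subst hw
    have all_empty : ∀ c : Composition ([] : List V).length,
        (([] : List V).splitWrtComposition c).map f = [] := fun c => by
      rw [List.map_eq_nil_iff, ← List.length_eq_zero_iff, List.length_splitWrtComposition]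
      exact Nat.le_zero.1 c.length_le
    simp only [all_empty, pullback_nil, Finset.sum_const, Finset.card_univ, composition_card]
    exact (one_nsmul _).symm
  | cons x w =>
    obtain ⟨n, rfl⟩ : ∃ m, n = m + 1 := ⟨n - 1, by simp at hw; omega⟩
    simp only [List.length_cons, Nat.add_right_cancel_iff] at hw
    unfold List.splitWrtComposition
    rw [sum_composition_succ (fun bs => Φ (((x :: w).splitWrtCompositionAux bs).map f)),
      pullback_cons, deconcatSum, hw]
    refine Finset.sum_congr rfl fun i _ => ?_
    rw [ih (n - i) (by omega) _ (w := w.drop i) (by simp [hw])]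
    simp [List.splitWrtComposition, List.splitWrtCompositionAux_cons]

theorem sum_Ioi_one_sub_blocksFun {n : ℕ} (c : Composition n) (j : Fin c.length) :
    ∑ i ∈ Finset.Ioi j, (1 - (c.blocksFun i : ℤ)) =
      (c.length - 1 - j : ℤ) - (n - c.sizeUpTo (j + 1)) := by
  have block_eq : ∀ i : Fin c.length, (1 - (c.blocksFun i : ℤ)) =
      ((i + 1 : ℕ) - c.sizeUpTo (i + 1) : ℤ) - (i - c.sizeUpTo i) := fun i => by
    rw [c.sizeUpTo_succ']
    push_cast
    ring
  have range_eq : (Finset.Ioi j).map Fin.valEmbedding = Finset.Ico ((j : ℕ) + 1) c.length := by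
    rw [Fin.map_valEmbedding_Ioi]
    ext
    simp
  rw [Finset.sum_congr rfl fun i _ => block_eq i]
  refine (Finset.sum_map (Finset.Ioi j) Fin.valEmbedding fun i : ℕ =>
    ((i + 1 : ℕ) - c.sizeUpTo (i + 1) : ℤ) - (i - c.sizeUpTo i)).symm.trans ?_
  rw [range_eq, Finset.sum_Ico_sub (fun i => (i - c.sizeUpTo i : ℤ)) j.2, c.sizeUpTo_length]
  push_cast
  ring

theorem neg_one_pow_composition {R : Type*} [CommRing R] {n : ℕ} (c : Composition n) :
    (-1 : R) ^ (∑ j : Fin c.length, (c.blocksFun j - 1) * c.sizeUpTo j) =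
      (-1) ^ n.choose 2 * (-1) ^ c.length.choose 2 *
        ∏ j : Fin c.length,
          (-1) ^ ((c.blocksFun j).choose 2 + (c.length - 1 - j) * (c.blocksFun j - 1)) := by
  let u : ℕ → ℕ := fun j => c.blocks.getD j 0 - 1
  have block_eq : ∀ j : Fin c.length, c.blocksFun j = u j + 1 := fun j => by
    have pos := c.one_le_blocksFun j
    have getD_eq : c.blocks.getD j 0 = c.blocksFun j :=
      List.getD_eq_getElem _ _ (by rw [c.blocks_length]; exact j.2)
    simp only [u, getD_eq]
    omega
  have sizeUpTo_eq : ∀ j ≤ c.length,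
      c.sizeUpTo j = ∑ i ∈ Finset.range j, (u i + 1) := fun j hj => by
    induction j with
    | zero => simp
    | succ j ih =>
      rw [Finset.sum_range_succ, ← ih (by omega), c.sizeUpTo_succ (by omega)]
      exact congrArg _ (block_eq ⟨j, by omega⟩)
  have choose_eq := choose_two_sum u c.length
  rw [← sizeUpTo_eq _ le_rfl, c.sizeUpTo_length] at choose_eq
  have weights_eq : ∑ j : Fin c.length, (c.blocksFun j - 1) * c.sizeUpTo j =
      ∑ j ∈ Finset.range c.length, u j * ∑ i ∈ Finset.range j, (u i + 1) := by
    rw [← Fin.sum_univ_eq_sum_range (fun j => u j * ∑ i ∈ Finset.range j, (u i + 1))]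
    exact Finset.sum_congr rfl fun j _ => by rw [block_eq, sizeUpTo_eq j j.2.le]; rfl
  simp only [block_eq, Nat.add_sub_cancel] at weights_eq ⊢
  rw [Fin.prod_univ_eq_prod_range (fun j => (-1 : R) ^ ((u j + 1).choose 2 +
    (c.length - 1 - j) * u j)) c.length, Finset.prod_pow_eq_pow_sum, weights_eq, ← pow_add,
    ← pow_add]
  refine neg_one_pow_congr ?_
  rw [choose_eq]
  simp only [Nat.even_add]
  tauto

end Compositions

section Relations

variable {k : Type*} [Field k] {N : ℕ} {V W X : Type*} [AddCommGroup V] [Module k V]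
  [AddCommGroup W] [Module k W] [AddCommGroup X] [Module k X]
  (𝒜 : ZMod N → Submodule k V) [DirectSum.Decomposition 𝒜]
  (ℬ : ZMod N → Submodule k W) [DirectSum.Decomposition ℬ]

theorem take_drop_signedWord {n r s t : ℕ} (h : n = r + s + t) (a : ℕ → V) :
    ((signedWord 𝒜 n a).drop r).take s = signedWord 𝒜 s fun j => koszul 𝒜 t (a (r + j)) := by
  subst h
  refine List.ext_getElem (by simp [length_signedWord]; omega) fun j _ _ => ?_
  simp only [signedWord, List.getElem_take, List.getElem_drop, List.getElem_ofFn, koszul_koszul]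
  congr 2
  push_cast
  ring

theorem take_signedWord (r t : ℕ) (a : ℕ → V) :
    (signedWord 𝒜 (r + t) a).take r = signedWord 𝒜 r fun j => koszul 𝒜 t (a j) := by
  simpa using take_drop_signedWord 𝒜 (r := 0) (s := r) (t := t) (by omega) a

theorem drop_signedWord (r s : ℕ) (a : ℕ → V) :
    (signedWord 𝒜 (r + s) a).drop r = signedWord 𝒜 s fun j => a (r + j) := by
  have h := take_drop_signedWord 𝒜 (n := r + s) (t := 0) rfl a
  rw [List.take_of_length_le (by simp [length_signedWord])] at h
  simpa [koszul_of_even] using h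

theorem map_shiftedKoszul_signedWord (q : ℤ) (n : ℕ) (a : ℕ → V) :
    (signedWord 𝒜 n a).map (shiftedKoszul 𝒜 q) =
      (signedWord 𝒜 n fun i => koszul 𝒜 q (a i)).map ((-1 : k) ^ q.natAbs • ·) := by
  refine List.ext_getElem (by simp [length_signedWord]) fun j _ _ => ?_
  simp only [signedWord, List.getElem_map, List.getElem_ofFn, shiftedKoszul_apply, koszul_koszul,
    add_comm]

variable {𝒜 ℬ} in
theorem koszul_apply_of_barShift (hN : Even N)
    {f : ∀ n : ℕ, MultilinearMap k (fun _ : Fin n => V) W} {c : ℤ}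
    (hf : IsShiftHomogeneous 𝒜 ℬ (barShift 𝒜 f) c) (q : ℤ) (n : ℕ) (a : ℕ → V) :
    koszul ℬ q (f n fun i => a i) =
      ((-1 : k) ^ (q.natAbs * (c.natAbs + n))) • f n fun i => koszul 𝒜 q (a i) := by
  have map_smul := (isWordMultilinear_barShift 𝒜 f).map_smul_append ((-1 : k) ^ q.natAbs)
    (signedWord 𝒜 n fun i => koszul 𝒜 q (a i)) []
  rw [List.append_nil, List.append_nil, ← map_shiftedKoszul_signedWord, length_signedWord]
    at map_smul
  rw [apply_eq_barShift 𝒜 f, map_smulₛₗ, hf.koszul_apply hN (isWordMultilinear_barShift 𝒜 f),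
    map_smul, apply_eq_barShift 𝒜 f n fun i => koszul 𝒜 q (a i), RingHom.id_apply, smul_smul,
    smul_smul, smul_smul, ← pow_mul, ← pow_add, ← pow_add, ← pow_add]
  congr 1
  refine neg_one_pow_congr ?_
  simp only [Nat.even_mul, Nat.even_add, even_val_intCast hN, Int.natAbs_even]
  tauto

theorem signedWord_splice {m : ∀ n : ℕ, MultilinearMap k (fun _ : Fin n => V) V} {r s t p : ℕ}
    (hp : p = r + (1 + t)) (a : ℕ → V) :
    signedWord 𝒜 p (splice 𝒜 (2 - (s : ℤ)) r (m s) a) =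
      (signedWord 𝒜 r fun j => koszul 𝒜 1 (koszul 𝒜 (s + t : ℕ) (a j))) ++
        koszul 𝒜 t (m s fun j => a (r + j)) :: signedWord 𝒜 t fun j => a (r + s + j) := by
  subst hp
  rw [← List.take_append_drop r (signedWord 𝒜 _ _), take_signedWord, drop_signedWord,
    ← List.take_append_drop 1 (signedWord 𝒜 (1 + t) _), take_signedWord, drop_signedWord]
  congr 1
  · refine congrArg List.ofFn (funext fun i => congrArg _ ?_)
    simp only [splice, if_pos i.2, koszul_koszul]
    refine LinearMap.congr_fun (koszul_congr 𝒜 ?_) _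
    rw [← Int.even_sub]
    exact ⟨1 - s, by push_cast; ring⟩
  · simp only [signedWord, List.ofFn_succ, List.ofFn_zero, List.cons_append, List.nil_append]
    congr 1
    · simp [splice, koszul_of_even]
    · refine congrArg List.ofFn (funext fun i => congrArg _ ?_)
      simp only [splice]
      rw [if_neg (by omega), if_neg (by omega)]
      congr 1
      omega

theorem smul_splice_eq_barShift (hN : Even N)
    (f : ∀ n : ℕ, MultilinearMap k (fun _ : Fin n => V) X)
    {m : ∀ n : ℕ, MultilinearMap k (fun _ : Fin n => V) V}
    (hm : IsShiftHomogeneous 𝒜 𝒜 (barShift 𝒜 m) 2) {r s t n p : ℕ} (hn : n = r + s + t)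
    (hp : p = r + (1 + t)) (a : ℕ → V) :
    ((-1 : k) ^ (r * s + t)) • f p (fun i => splice 𝒜 (2 - (s : ℤ)) r (m s) a i) =
      ((-1 : k) ^ n.choose 2) • barShift 𝒜 f
        (((signedWord 𝒜 n a).take r).map (shiftedKoszul 𝒜 1) ++
          barShift 𝒜 m (((signedWord 𝒜 n a).drop r).take s) ::
            (signedWord 𝒜 n a).drop (r + s)) := by
  have inner : barShift 𝒜 m (((signedWord 𝒜 n a).drop r).take s) =
      ((-1 : k) ^ (s.choose 2 + t * s)) • koszul 𝒜 t (m s fun j => a (r + j)) := by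
    have := koszul_apply_of_barShift hN (c := 2) (by simpa using hm) t s fun j => a (r + j)
    rw [take_drop_signedWord 𝒜 hn, barShift_signedWord, this, smul_smul, ← pow_add]
    congr 1
    refine neg_one_pow_congr ?_
    simp [parity_simps]
    tauto
  have f_multilinear := isWordMultilinear_barShift 𝒜 f
  rw [apply_eq_barShift 𝒜 f, signedWord_splice 𝒜 hp, inner,
    (f_multilinear _ _).map_smul, show n = r + (s + t) by omega, take_signedWord,
    map_shiftedKoszul_signedWord, f_multilinear.map_smul_append, length_signedWord, ← add_assoc,
    drop_signedWord]
  simp only [smul_smul, Int.natAbs_one, pow_one, ← pow_add]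
  have exponents : r * s + t + p.choose 2 + 2 * (s.choose 2 + t * s) =
      (r + s + t).choose 2 + (s.choose 2 + t * s + r) + 2 * t := by
    simp only [hp, choose_two_add, Nat.choose_eq_zero_of_lt one_lt_two]
    ring
  congr 1
  refine neg_one_pow_congr ?_
  rw [Nat.even_iff, Nat.even_iff]
  omega

theorem sum_splice_eq_insertionPart (hN : Even N)
    (f : ∀ n : ℕ, MultilinearMap k (fun _ : Fin n => V) X)
    {m : ∀ n : ℕ, MultilinearMap k (fun _ : Fin n => V) V}
    (hm : IsShiftHomogeneous 𝒜 𝒜 (barShift 𝒜 m) 2) {s n : ℕ} (hs : s ≤ n) (a : ℕ → V) :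
    ∑ r ∈ Finset.range (n - s + 1), ((-1 : k) ^ (r * s + (n - r - s))) •
        f (n - s + 1) (fun i => splice 𝒜 (2 - (s : ℤ)) r (m s) a i) =
      ((-1 : k) ^ n.choose 2) •
        insertionPart (shiftedKoszul 𝒜 1) (barShift 𝒜 m) (barShift 𝒜 f) s (signedWord 𝒜 n a) := by
  rw [insertionPart, length_signedWord, Nat.sub_add_comm hs, Finset.smul_sum]
  refine Finset.sum_congr rfl fun r hr => ?_
  rw [Finset.mem_range] at hr
  exact smul_splice_eq_barShift 𝒜 hN f hm (by omega) (by omega) a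

theorem insertSum_eq_insertion (hN : Even N)
    (f : ∀ n : ℕ, MultilinearMap k (fun _ : Fin n => V) X)
    {m : ∀ n : ℕ, MultilinearMap k (fun _ : Fin n => V) V}
    (hm : IsShiftHomogeneous 𝒜 𝒜 (barShift 𝒜 m) 2) (n : ℕ) (a : ℕ → V) :
    insertSum 𝒜 f m n a = ((-1 : k) ^ n.choose 2) •
      insertion (shiftedKoszul 𝒜 1) (barShift 𝒜 m) (barShift 𝒜 f) (signedWord 𝒜 n a) := by
  rw [insertSum, insertion_eq_sum_insertionPart, length_signedWord, Finset.smul_sum]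
  exact Finset.sum_congr rfl fun s hs =>
    sum_splice_eq_insertionPart 𝒜 hN f hm (Finset.mem_Icc.1 hs).2 a

variable {𝒜 ℬ} in
theorem koszul_barShift_block (hN : Even N)
    {f : ∀ n : ℕ, MultilinearMap k (fun _ : Fin n => V) W}
    (hf : IsShiftHomogeneous 𝒜 ℬ (barShift 𝒜 f) 1) {n : ℕ} (c : Composition n) (j : Fin c.length)
    (a : ℕ → V) :
    koszul ℬ ((c.length : ℤ) - 1 - j)
        (barShift 𝒜 f (((signedWord 𝒜 n a).take (c.sizeUpTo (j + 1))).drop (c.sizeUpTo j))) =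
      ((-1 : k) ^ ((c.blocksFun j).choose 2 + (c.length - 1 - j) * (c.blocksFun j - 1))) •
        f (c.blocksFun j) fun i =>
          koszul 𝒜 (∑ j' ∈ Finset.Ioi j, (1 - (c.blocksFun j' : ℤ))) (a (c.sizeUpTo j + i)) := by
  obtain ⟨q, hq⟩ : ∃ q, c.length = q + (j + 1) := ⟨c.length - (j + 1), by omega⟩
  obtain ⟨t, ht⟩ := Nat.exists_eq_add_of_le (c.sizeUpTo_le (j + 1))
  obtain ⟨u, hu⟩ := Nat.exists_eq_add_of_le (c.one_le_blocksFun j)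
  rw [c.sizeUpTo_succ'] at ht
  have block : ((signedWord 𝒜 n a).take (c.sizeUpTo (j + 1))).drop (c.sizeUpTo j) =
      signedWord 𝒜 (c.blocksFun j) fun i => koszul 𝒜 t (a (c.sizeUpTo j + i)) := by
    rw [List.drop_take, c.sizeUpTo_succ', Nat.add_sub_cancel_left, take_drop_signedWord 𝒜 ht]
  have parity : koszul 𝒜 ((q : ℤ) + t) =
      koszul 𝒜 (∑ j' ∈ Finset.Ioi j, (1 - (c.blocksFun j' : ℤ))) := by
    refine koszul_congr 𝒜 ?_
    rw [sum_Ioi_one_sub_blocksFun, c.sizeUpTo_succ', ← Int.even_sub]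
    exact ⟨t, by omega⟩
  have move_sign := koszul_apply_of_barShift hN (c := 1) (by simpa using hf) q (c.blocksFun j)
    fun i => koszul 𝒜 t (a (c.sizeUpTo j + i))
  rw [block, barShift_signedWord, map_smul, show (c.length : ℤ) - 1 - j = q by omega, move_sign]
  simp only [koszul_koszul, parity, smul_smul, ← pow_add]
  congr 1
  refine neg_one_pow_congr ?_
  rw [show c.length - 1 - j = q by omega, hu, Nat.add_sub_cancel_left]
  simp only [Int.natAbs_natCast, Int.natAbs_one, Nat.even_add, Nat.even_mul, Nat.not_even_one]
  tauto

variable {𝒜 ℬ} in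
theorem compSum_eq_pullback (hN : Even N) (g : ∀ n : ℕ, MultilinearMap k (fun _ : Fin n => W) X)
    {f : ∀ n : ℕ, MultilinearMap k (fun _ : Fin n => V) W}
    (hf : IsShiftHomogeneous 𝒜 ℬ (barShift 𝒜 f) 1) (n : ℕ) (a : ℕ → V) :
    compSum 𝒜 g f n a =
      ((-1 : k) ^ n.choose 2) • pullback (barShift 𝒜 f) (barShift ℬ g) (signedWord 𝒜 n a) := by
  rw [pullback_eq_sum_composition _ _ (length_signedWord 𝒜 n a), Finset.smul_sum, compSum]
  refine Finset.sum_congr rfl fun c _ => ?_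
  have blocks : ∀ j : Fin c.length,
      (((signedWord 𝒜 n a).splitWrtComposition c).map (barShift 𝒜 f)).getD j 0 =
        barShift 𝒜 f
          (((signedWord 𝒜 n a).take (c.sizeUpTo (j + 1))).drop (c.sizeUpTo j)) := fun j => by
    rw [List.getD_eq_getElem _ _ (by simp), List.getElem_map, List.getElem_splitWrtComposition']
  rw [barShift_of_length ℬ g (n := c.length) (by simp), neg_one_pow_composition]
  simp only [blocks, koszul_barShift_block hN hf, MultilinearMap.map_smul_univ, smul_smul]
  rw [mul_assoc]

end Relations

theorem isHomogeneous_of_one_le {k : Type*} [Field k] {N : ℕ} {V W : Type*} [AddCommGroup V]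
    [Module k V] [AddCommGroup W] [Module k W] {𝒜 : ZMod N → Submodule k V}
    {ℬ : ZMod N → Submodule k W} {f : ∀ n : ℕ, MultilinearMap k (fun _ : Fin n => V) W} {c : ℤ}
    (h0 : f 0 = 0) (h : ∀ n : ℕ, 1 ≤ n → IsHomogeneous 𝒜 ℬ (f n) (c - n)) (n : ℕ) :
    IsHomogeneous 𝒜 ℬ (f n) (c - n) := by
  rcases n.eq_zero_or_pos with rfl | hn
  · rw [h0]
    exact fun _ _ _ => Submodule.zero_mem _
  · exact h n hn

section Structures

variable {k : Type*} [Field k] {N : ℕ}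
  {V : Type*} [AddCommGroup V] [Module k V] {𝒜 : ZMod N → Submodule k V} [DirectSum.Decomposition 𝒜]
  {W : Type*} [AddCommGroup W] [Module k W] {ℬ : ZMod N → Submodule k W} [DirectSum.Decomposition ℬ]
  {X : Type*} [AddCommGroup X] [Module k X] {𝒞 : ZMod N → Submodule k X} [DirectSum.Decomposition 𝒞]

theorem eq_of_signedWord {P Q : List V → X} (h0 : P [] = Q [])
    (h : ∀ n : ℕ, 1 ≤ n → ∀ a : ℕ → V, ((-1 : k) ^ n.choose 2) • P (signedWord 𝒜 n a) =
      ((-1 : k) ^ n.choose 2) • Q (signedWord 𝒜 n a)) (w : List V) : P w = Q w := by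
  rcases w.length.eq_zero_or_pos with hw | hw
  · rw [List.length_eq_zero_iff.1 hw, h0]
  · obtain ⟨a, ha⟩ := exists_signedWord 𝒜 w
    rw [ha]
    exact smul_right_injective X (pow_ne_zero _ (neg_ne_zero.2 one_ne_zero)) (h _ hw a)

namespace Algebra

/-- The operations of `A` after lowering all degrees by one: the corestriction of the differential
of the bar construction. -/
noncomputable def word (A : Algebra 𝒜) : List V → V := barShift 𝒜 A.m

theorem isBarDifferential_word (hN : Even N) (A : Algebra 𝒜) : IsBarDifferential 𝒜 A.word := by
  have homogeneous : IsShiftHomogeneous 𝒜 𝒜 A.word 2 := by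
    simpa [word] using isShiftHomogeneous_barShift (c := 2)
      (isHomogeneous_of_one_le A.m_zero A.homogeneous)
  refine ⟨isWordMultilinear_barShift 𝒜 _, homogeneous, barShift_eq_zero 𝒜 A.m_zero, ?_⟩
  refine eq_of_signedWord (𝒜 := 𝒜) (Q := fun _ => 0) rfl fun n hn a => ?_
  rw [word, ← insertSum_eq_insertion 𝒜 hN A.m homogeneous, A.relation n hn, smul_zero]

/-- The `A∞`-structure with a given bar differential. -/
noncomputable def ofWord (hN : Even N) (b : List V → V) (h : IsBarDifferential 𝒜 b) :
    Algebra 𝒜 where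
  m := barUnshift 𝒜 b h.multilinear
  m_zero := multilinear_eq_zero_of_barShift 𝒜 fun w hw => by
    rw [barShift_barUnshift, List.length_eq_zero_iff.1 hw, h.map_nil]
  homogeneous n _ := isHomogeneous_barUnshift _ (c := 2) (by simpa using h.homogeneous) n
  relation n _ a := by
    have shift_eq := barShift_barUnshift 𝒜 h.multilinear
    rw [insertSum_eq_insertion 𝒜 hN _ (by rw [shift_eq]; exact h.homogeneous), shift_eq,
      h.insertion_self, smul_zero]

theorem word_ofWord (hN : Even N) (b : List V → V) (h : IsBarDifferential 𝒜 b) :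
    (ofWord hN b h).word = b :=
  barShift_barUnshift 𝒜 h.multilinear

end Algebra

namespace Hom

/-- The components of `F` after lowering all degrees by one: the corestriction of the morphism
induced between the bar constructions. -/
noncomputable def word {A : Algebra 𝒜} {B : Algebra ℬ} (F : Hom A B) : List V → W :=
  barShift 𝒜 F.f

theorem isBarMorphism_word (hN : Even N) {A : Algebra 𝒜} {B : Algebra ℬ} (F : Hom A B) :
    IsBarMorphism 𝒜 ℬ A.word B.word F.word := by
  have homogeneous : IsShiftHomogeneous 𝒜 ℬ F.word 1 := by
    simpa [word] using isShiftHomogeneous_barShift (c := 1)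
      (isHomogeneous_of_one_le F.f_zero F.homogeneous)
  refine ⟨isWordMultilinear_barShift 𝒜 _, homogeneous, barShift_eq_zero 𝒜 F.f_zero, ?_⟩
  refine eq_of_signedWord (𝒜 := 𝒜) (B.isBarDifferential_word hN).map_nil fun n hn a => ?_
  rw [word, Algebra.word, Algebra.word,
    ← insertSum_eq_insertion 𝒜 hN F.f (A.isBarDifferential_word hN).homogeneous,
    ← compSum_eq_pullback hN B.m homogeneous, F.relation n hn]

/-- The morphism of `A∞`-algebras with a given effect on bar constructions. -/
noncomputable def ofWord (hN : Even N) (A : Algebra 𝒜) (B : Algebra ℬ) (f : List V → W)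
    (h : IsBarMorphism 𝒜 ℬ A.word B.word f) : Hom A B where
  f := barUnshift 𝒜 f h.multilinear
  f_zero := multilinear_eq_zero_of_barShift 𝒜 fun w hw => by
    rw [barShift_barUnshift, List.length_eq_zero_iff.1 hw, h.map_nil]
  homogeneous n _ := isHomogeneous_barUnshift _ (c := 1) (by simpa using h.homogeneous) n
  relation n _ a := by
    have shift_eq := barShift_barUnshift 𝒜 h.multilinear
    rw [insertSum_eq_insertion 𝒜 hN _ (A.isBarDifferential_word hN).homogeneous,
      compSum_eq_pullback hN _ (by rw [shift_eq]; exact h.homogeneous), shift_eq]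
    exact congrArg _ (h.pullback_eq _)

theorem word_ofWord (hN : Even N) (A : Algebra 𝒜) (B : Algebra ℬ) (f : List V → W)
    (h : IsBarMorphism 𝒜 ℬ A.word B.word f) : (ofWord hN A B f h).word = f :=
  barShift_barUnshift 𝒜 h.multilinear

/-- The identity morphism. -/
noncomputable def id (hN : Even N) (A : Algebra 𝒜) : Hom A A :=
  ofWord hN A A letter (.letter (A.isBarDifferential_word hN))

theorem id_f (hN : Even N) (A : Algebra 𝒜) : (id hN A).f = idMaps k V :=
  funext fun _ => multilinear_eq_of_barShift_eq 𝒜 fun w _ =>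
    congrFun ((word_ofWord hN A A letter _).trans (barShift_idMaps 𝒜).symm) w

/-- The composite of two morphisms. -/
noncomputable def comp (hN : Even N) {A : Algebra 𝒜} {B : Algebra ℬ} {C : Algebra 𝒞}
    (G : Hom B C) (F : Hom A B) : Hom A C :=
  ofWord hN A C (pullback F.word G.word)
    ((F.isBarMorphism_word hN).pullback hN (G.isBarMorphism_word hN)
      (B.isBarDifferential_word hN).map_nil (C.isBarDifferential_word hN).multilinear)

theorem isComp_comp (hN : Even N) {A : Algebra 𝒜} {B : Algebra ℬ} {C : Algebra 𝒞} (G : Hom B C)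
    (F : Hom A B) : G.IsComp F (comp hN G F) := by
  intro n _ a
  rw [apply_eq_barShift 𝒜, compSum_eq_pullback hN _ (F.isBarMorphism_word hN).homogeneous]
  exact congrArg (_ • ·) (congrFun (word_ofWord hN A C (pullback F.word G.word) _) _)

variable {A B : Algebra 𝒜}

theorem isUnipotent_barShift {f : ∀ n : ℕ, MultilinearMap k (fun _ : Fin n => V) V} (h0 : f 0 = 0)
    (h1 : f 1 = idMaps k V 1) : IsUnipotent k (barShift 𝒜 f) where
  multilinear := isWordMultilinear_barShift 𝒜 f
  map_nil := barShift_eq_zero 𝒜 h0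
  map_singleton x := by
    rw [barShift_congr 𝒜 (g := idMaps k V) h1, barShift_idMaps, letter_singleton]

theorem compSum_eq_idMaps (hN : Even N) (F : Hom A B) (G : Hom B A)
    (h : ∀ w, pullback F.word G.word w = letter w) (n : ℕ) (a : ℕ → V) :
    compSum 𝒜 G.f F.f n a = idMaps k V n (fun i => a i) := by
  rw [compSum_eq_pullback hN _ (F.isBarMorphism_word hN).homogeneous, apply_eq_barShift 𝒜,
    barShift_idMaps]
  exact congrArg (_ • ·) (h _)

theorem isIso_of_f_one (hN : Even N) (F : Hom A B) (h : F.f 1 = idMaps k V 1) : F.IsIso := by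
  have unipotent : IsUnipotent k F.word := isUnipotent_barShift F.f_zero h
  have differential := B.isBarDifferential_word hN
  let G : Hom B A := ofWord hN B A (substInv F.word) <|
    unipotent.isBarMorphism_substInv hN (F.isBarMorphism_word hN)
      (A.isBarDifferential_word hN).map_nil differential.multilinear differential.map_nil
  have word_G : G.word = substInv F.word := word_ofWord hN B A _ _
  refine ⟨G, fun n _ => compSum_eq_idMaps hN F G (fun w => ?_) n,
    fun n _ => compSum_eq_idMaps hN G F (fun w => ?_) n⟩
  · rw [word_G, unipotent.pullback_substInv]
  · rw [word_G, unipotent.pullback_substInv_left]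

theorem exists_transport (hN : Even N) (A : Algebra 𝒜)
    (f : ∀ n : ℕ, MultilinearMap k (fun _ : Fin n => V) V)
    (hf : ∀ n : ℕ, IsHomogeneous 𝒜 𝒜 (f n) (1 - (n : ℤ))) (h0 : f 0 = 0)
    (h1 : f 1 = idMaps k V 1) : ∃ (B : Algebra 𝒜) (F : Hom A B), F.f = f := by
  have unipotent : IsUnipotent k (barShift 𝒜 f) := isUnipotent_barShift h0 h1
  have homogeneous : IsShiftHomogeneous 𝒜 𝒜 (barShift 𝒜 f) 1 := by
    simpa using isShiftHomogeneous_barShift (c := 1) hf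
  have differential := A.isBarDifferential_word hN
  let B : Algebra 𝒜 := .ofWord hN (barTransport 𝒜 A.word (barShift 𝒜 f))
    (unipotent.isBarDifferential_barTransport hN homogeneous differential)
  have morphism : IsBarMorphism 𝒜 𝒜 A.word B.word (barShift 𝒜 f) := by
    rw [Algebra.word_ofWord]
    exact unipotent.isBarMorphism_barTransport homogeneous differential.multilinear
  refine ⟨B, ofWord hN A B _ morphism, funext fun n => ?_⟩
  exact multilinear_eq_of_barShift_eq 𝒜 fun w _ => congrFun (word_ofWord hN A B _ morphism) w

end Hom

end Structures

section Hochschild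

variable {k : Type*} [Field k] {N : ℕ} {V : Type*} [AddCommGroup V] [Module k V]
  (𝒜 : ZMod N → Submodule k V) [DirectSum.Decomposition 𝒜]
  {f m : ∀ n : ℕ, MultilinearMap k (fun _ : Fin n => V) V}

theorem signedWord_one (a : ℕ → V) : signedWord 𝒜 1 a = [a 0] := by
  simp [signedWord, koszul_of_even]

theorem product_eq_neg_barShift (x y : V) : m 2 ![x, y] = -barShift 𝒜 m [koszul 𝒜 1 x, y] := by
  have entries : signedWord 𝒜 2 (fun i => if i = 0 then x else y) = [koszul 𝒜 1 x, y] := by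
    simp [signedWord, koszul_of_even]
  rw [← entries, barShift_signedWord, Nat.choose_self, pow_one, neg_one_smul, neg_neg]
  congr 1
  funext i
  fin_cases i <;> rfl

theorem left_product_eq_barShift (c : ℤ) (n : ℕ) (a : ℕ → V) :
    m 2 ![koszul 𝒜 (c - n) (a 0), f n fun i => a (i + 1)] =
      ((-1 : k) ^ n.choose 2) • ((-1 : k) ^ c.natAbs) • barShift 𝒜 m
        (((signedWord 𝒜 (n + 1) a).take 1).map (shiftedKoszul 𝒜 (c - 1)) ++
          [barShift 𝒜 f ((signedWord 𝒜 (n + 1) a).drop 1)]) := by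
  have m_multilinear := isWordMultilinear_barShift 𝒜 m
  have smul_last (e : k) (x y : V) : barShift 𝒜 m [x, e • y] = e • barShift 𝒜 m [x, y] :=
    (m_multilinear [x] []).map_smul e y
  have sign : (-1 : k) ^ c.natAbs * (-1) ^ (c - 1).natAbs = -1 := by
    rw [← pow_add]
    refine Odd.neg_one_pow ?_
    simp only [← Nat.not_even_iff_odd, Nat.even_add, Int.natAbs_even, Int.even_sub,
      Int.not_even_one]
    tauto
  have koszul_eq : koszul 𝒜 1 (koszul 𝒜 (c - n) (a 0)) =
      koszul 𝒜 (c - 1) (koszul 𝒜 n (a 0)) := by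
    rw [koszul_koszul, koszul_koszul]
    refine LinearMap.congr_fun (koszul_congr 𝒜 ?_) _
    simp only [Int.even_add, Int.even_sub, Int.not_even_one]
    tauto
  have shift_f : f n (fun i => a (i + 1)) =
      ((-1 : k) ^ n.choose 2) • barShift 𝒜 f (signedWord 𝒜 n fun j => a (1 + j)) := by
    simp only [add_comm 1, apply_eq_barShift 𝒜 f n fun i => a (i + 1)]
  rw [add_comm n 1, take_signedWord, drop_signedWord, signedWord_one, List.map_singleton,
    List.singleton_append, shiftedKoszul_apply, product_eq_neg_barShift 𝒜, koszul_eq, shift_f,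
    smul_last, (m_multilinear.head _).map_smul, smul_smul ((-1 : k) ^ c.natAbs), sign,
    neg_one_smul, smul_neg]

variable {𝒜}

theorem right_product_eq_barShift (hN : Even N) {c : ℤ}
    (hf : IsShiftHomogeneous 𝒜 𝒜 (barShift 𝒜 f) c) (n : ℕ) (a : ℕ → V) :
    ((-1 : k) ^ (n + 1)) • m 2 ![f n fun i => a i, a n] =
      ((-1 : k) ^ n.choose 2) • ((-1 : k) ^ c.natAbs) • barShift 𝒜 m
        (barShift 𝒜 f ((signedWord 𝒜 (n + 1) a).take n) :: (signedWord 𝒜 (n + 1) a).drop n) := by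
  have m_multilinear := isWordMultilinear_barShift 𝒜 m
  rw [take_signedWord, drop_signedWord, signedWord_one, barShift_signedWord,
    product_eq_neg_barShift 𝒜, koszul_apply_of_barShift hN hf, (m_multilinear.head _).map_smul,
    (m_multilinear.head _).map_smul, smul_neg, ← neg_smul, smul_smul, smul_smul, smul_smul]
  congr 1
  rw [mul_right_comm, neg_one_pow_mul_self, one_mul, ← neg_one_mul, ← pow_succ', ← pow_add]
  refine neg_one_pow_congr ?_
  simp [parity_simps]
  tauto

theorem sum_inner_product_eq_insertionPart (hN : Even N)
    (hm : IsShiftHomogeneous 𝒜 𝒜 (barShift 𝒜 m) 2) (n : ℕ) (a : ℕ → V) :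
    ∑ r ∈ Finset.range n, ((-1 : k) ^ (r + 1)) • f n (fun i => splice 𝒜 0 r (m 2) a i) =
      ((-1 : k) ^ n.choose 2) • insertionPart (shiftedKoszul 𝒜 1) (barShift 𝒜 m) (barShift 𝒜 f) 2
        (signedWord 𝒜 (n + 1) a) := by
  rw [insertionPart, length_signedWord, Finset.smul_sum]
  refine Finset.sum_congr rfl fun r hr => ?_
  rw [Finset.mem_range] at hr
  have shifted := smul_splice_eq_barShift 𝒜 hN f hm (r := r) (s := 2) (t := n - 1 - r)
    (n := n + 1) (p := n) (by omega) (by omega) a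
  have signs : (-1 : k) ^ (r + 1) =
      (-1) ^ (n.choose 2 + (n + 1).choose 2 + (r * 2 + (n - 1 - r))) := by
    refine neg_one_pow_congr ?_
    rw [choose_two_add, Nat.even_iff, Nat.even_iff, Nat.choose_eq_zero_of_lt one_lt_two]
    omega
  rw [Nat.cast_ofNat, sub_self] at shifted
  rw [signs, pow_add, mul_smul, shifted, smul_smul, pow_add, mul_assoc, neg_one_pow_mul_self,
    mul_one]

theorem hochschildDiff_eq (hN : Even N) (hm : IsShiftHomogeneous 𝒜 𝒜 (barShift 𝒜 m) 2) {c : ℤ}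
    (hf : IsShiftHomogeneous 𝒜 𝒜 (barShift 𝒜 f) c) (n : ℕ) (a : ℕ → V) {w : List V}
    (hw : w = signedWord 𝒜 (n + 1) a) :
    hochschildDiff 𝒜 (m 2) n (c - n) (f n) a = ((-1 : k) ^ n.choose 2) •
      (insertionPart (shiftedKoszul 𝒜 1) (barShift 𝒜 m) (barShift 𝒜 f) 2 w +
        ((-1 : k) ^ c.natAbs) • (barShift 𝒜 m (barShift 𝒜 f (w.take n) :: w.drop n) +
          barShift 𝒜 m ((w.take 1).map (shiftedKoszul 𝒜 (c - 1)) ++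
            [barShift 𝒜 f (w.drop 1)]))) := by
  rw [hw, smul_add, smul_add, smul_add, ← left_product_eq_barShift,
    ← right_product_eq_barShift hN hf, ← sum_inner_product_eq_insertionPart hN hm]
  simp only [hochschildDiff, LinearMap.coe_mk, AddHom.coe_mk]
  abel

end Hochschild

section ElementaryMaps

variable {k : Type*} [Field k] {V : Type*} [AddCommGroup V] [Module k V]

theorem idMaps_of_ne_one {l : ℕ} (hl : l ≠ 1) : idMaps k V l = 0 := by
  match l with
  | 0 | _ + 2 => rfl

/-- The components of a morphism that differs from the identity by one component `φ`, of arity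
`p`. -/
noncomputable def elementaryMaps {p : ℕ} (φ : MultilinearMap k (fun _ : Fin p => V) V) :
    ∀ n : ℕ, MultilinearMap k (fun _ : Fin n => V) V :=
  Function.update (idMaps k V) p φ

variable {p : ℕ} (φ : MultilinearMap k (fun _ : Fin p => V) V)

theorem elementaryMaps_self : elementaryMaps φ p = φ :=
  Function.update_self ..

theorem elementaryMaps_of_ne {l : ℕ} (hl : l ≠ p) : elementaryMaps φ l = idMaps k V l :=
  Function.update_of_ne hl ..

variable {φ} {N : ℕ} {𝒜 : ZMod N → Submodule k V}

theorem isHomogeneous_idMaps (n : ℕ) : IsHomogeneous 𝒜 𝒜 (idMaps k V n) (1 - (n : ℤ)) := by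
  rcases eq_or_ne n 1 with rfl | hn
  · intro d a ha
    simpa [idMaps] using ha 0
  · rw [idMaps_of_ne_one hn]
    exact fun _ _ _ => Submodule.zero_mem _

theorem isHomogeneous_elementaryMaps (hφ : IsHomogeneous 𝒜 𝒜 φ (1 - (p : ℤ))) (n : ℕ) :
    IsHomogeneous 𝒜 𝒜 (elementaryMaps φ n) (1 - (n : ℤ)) := by
  rcases eq_or_ne n p with rfl | hn
  · rwa [elementaryMaps_self]
  · rw [elementaryMaps_of_ne φ hn]
    exact isHomogeneous_idMaps n

end ElementaryMaps

section Obstruction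

variable {k : Type*} [Field k] {N : ℕ} {V : Type*} [AddCommGroup V] [Module k V]
  {𝒜 : ZMod N → Submodule k V} [DirectSum.Decomposition 𝒜]

theorem Algebra.IsMinimal.word_singleton {A : Algebra 𝒜} (hA : A.IsMinimal) (x : V) :
    A.word [x] = 0 :=
  barShift_eq_zero 𝒜 hA

theorem Algebra.IsMinimal.hochschildDiff_m_eq_zero (hN : Even N) {A : Algebra 𝒜}
    (hA : A.IsMinimal) {n : ℕ} (hn : 3 ≤ n) (h : ∀ l, 3 ≤ l → l < n → A.m l = 0) :
    hochschildDiff 𝒜 (A.m 2) n (2 - (n : ℤ)) (A.m n) = 0 := by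
  funext a
  have differential := A.isBarDifferential_word hN
  have relation := insertion_self_of_length_eq_succ (shiftedKoszul 𝒜 1) hn differential.multilinear
    hA.word_singleton (fun v hv hvn => barShift_eq_zero 𝒜 (h _ hv hvn))
    (length_signedWord 𝒜 (n + 1) a)
  rw [differential.insertion_self] at relation
  rw [hochschildDiff_eq hN differential.homogeneous
      (by simpa [Algebra.word] using differential.homogeneous) n a rfl,
    show (2 : ℤ) - 1 = 1 by rfl, show (2 : ℤ).natAbs = 2 by rfl, neg_one_sq, one_smul]
  exact (congrArg _ relation.symm).trans (smul_zero _)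

theorem evalSeq_injective (n : ℕ) : Function.Injective (evalSeq k V n) := fun φ ψ h => by
  ext a
  obtain ⟨b, rfl⟩ := exists_seq a
  exact congrFun h b

theorem exists_hochschildDiff_eq {μ : MultilinearMap k (fun _ : Fin 2 => V) V} {n : ℕ} {q : ℤ}
    (h : Subsingleton (HochschildCohomology 𝒜 μ (n + 1) q))
    {φ : MultilinearMap k (fun _ : Fin (n + 1) => V) V} (hφ : IsHomogeneous 𝒜 𝒜 φ q)
    (hd : hochschildDiff 𝒜 μ (n + 1) q φ = 0) :
    ∃ ψ : MultilinearMap k (fun _ : Fin n => V) V, IsHomogeneous 𝒜 𝒜 ψ q ∧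
      hochschildDiff 𝒜 μ n q ψ = evalSeq k V (n + 1) φ := by
  have coboundary : (⟨φ, hφ, hd⟩ : hochschildCocycles 𝒜 μ (n + 1) q) ∈
      (hochschildCoboundaries 𝒜 μ (n + 1) q).comap (hochschildCocycles 𝒜 μ (n + 1) q).subtype :=
    (Submodule.Quotient.mk_eq_zero _).1 (h.elim _ _)
  exact coboundary.2

variable (𝒜) in
theorem isElementary_barShift_elementaryMaps {p : ℕ} (hp : p ≠ 1)
    (φ : MultilinearMap k (fun _ : Fin p => V) V) :
    IsElementary (barShift 𝒜 (elementaryMaps φ)) p where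
  map_singleton x := by
    rw [barShift_congr 𝒜 (g := idMaps k V) (elementaryMaps_of_ne φ (by simpa using hp.symm)),
      barShift_idMaps, letter_singleton]
  eq_zero u hu hup := barShift_eq_zero 𝒜 <| by
    rw [elementaryMaps_of_ne φ hup, idMaps_of_ne_one hu]

namespace Hom

section Elementary

variable {A B : Algebra 𝒜} {F : Hom A B} {p : ℕ}

theorem word_eq_of_isElementary (hN : Even N) (hA : A.IsMinimal) (hF : IsElementary F.word p)
    (hp : 2 ≤ p) {w : List V} (hw : w.length ≤ p) : B.word w = A.word w := by
  have morphism := F.isBarMorphism_word hN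
  have hB := (B.isBarDifferential_word hN).multilinear
  have insertion_eq : ∀ v : List V, v.length ≤ p →
      pullback F.word B.word v = A.word v := fun v hv => by
    rw [morphism.pullback_eq, hF.insertion_of_length_le _ morphism.multilinear
      (A.isBarDifferential_word hN).map_nil hA.word_singleton hv]
  have short : ∀ v : List V, v.length < p → B.word v = A.word v := fun v hv => by
    rw [← hF.pullback_of_length_lt hB hv, insertion_eq v hv.le]
  rcases hw.lt_or_eq with hlt | heq
  · exact short w hlt
  · rw [← insertion_eq w hw, hF.pullback_of_length_eq hp hB heq, short [F.word w] (by simp; omega),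
      hA.word_singleton, add_zero]

theorem m_eq_of_isElementary (hN : Even N) (hA : A.IsMinimal) (hF : IsElementary F.word p)
    (hp : 2 ≤ p) {l : ℕ} (hl : l ≤ p) : B.m l = A.m l :=
  multilinear_eq_of_barShift_eq 𝒜 fun _ hw => word_eq_of_isElementary hN hA hF hp (hw.trans_le hl)

theorem word_eq_add_of_isElementary (hN : Even N) (hA : A.IsMinimal) (hF : IsElementary F.word p)
    (hp : 2 ≤ p) (a : ℕ → V) :
    B.word (signedWord 𝒜 (p + 1) a) = A.word (signedWord 𝒜 (p + 1) a) +
      ((-1 : k) ^ p.choose 2) • hochschildDiff 𝒜 (A.m 2) p (1 - (p : ℤ)) (F.f p) a := by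
  have morphism := F.isBarMorphism_word hN
  have differential := A.isBarDifferential_word hN
  have length_w := length_signedWord 𝒜 (p + 1) a
  have diff_eq := hochschildDiff_eq hN differential.homogeneous (c := 1)
    (by simpa [word] using morphism.homogeneous) p a rfl
  have relation := morphism.pullback_eq (signedWord 𝒜 (p + 1) a)
  rw [hF.pullback_of_length_eq_succ hp (B.isBarDifferential_word hN).multilinear length_w,
    hF.insertion_of_length_eq_succ _ hp morphism.multilinear hA.word_singleton length_w,
    word_eq_of_isElementary hN hA hF hp (w := _ ++ _) (by simpa [length_w] using hp),
    word_eq_of_isElementary hN hA hF hp (w := _ :: _) (by simpa [length_w] using hp)] at relation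
  have shiftedKoszul_zero : ⇑(shiftedKoszul 𝒜 (1 - 1)) = _root_.id := funext fun x => by
    simp [shiftedKoszul_apply, koszul_of_even]
  rw [diff_eq, smul_smul, neg_one_pow_mul_self, one_smul, shiftedKoszul_zero, List.map_id,
    Int.natAbs_one, pow_one, neg_one_smul]
  change _ = A.word _ + (insertionPart _ A.word F.word 2 _ + -(A.word _ + A.word _))
  rw [eq_sub_of_add_eq (eq_sub_of_add_eq relation)]
  abel

theorem evalSeq_m_succ_of_isElementary (hN : Even N) (hA : A.IsMinimal)
    (hF : IsElementary F.word p) (hp : 2 ≤ p) :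
    evalSeq k V (p + 1) (B.m (p + 1)) = evalSeq k V (p + 1) (A.m (p + 1)) +
      ((-1 : k) ^ p) • hochschildDiff 𝒜 (A.m 2) p (1 - (p : ℤ)) (F.f p) := by
  funext a
  have sign : (-1 : k) ^ ((p + 1).choose 2) * (-1) ^ p.choose 2 = (-1) ^ p := by
    rw [choose_two_add, ← pow_add]
    refine neg_one_pow_congr ?_
    simp only [Nat.choose_eq_zero_of_lt one_lt_two, Nat.even_iff]
    omega
  change B.m (p + 1) (fun i => a i) = A.m (p + 1) (fun i => a i) + _
  rw [apply_eq_barShift 𝒜 B.m, apply_eq_barShift 𝒜 A.m, ← sign, mul_smul, Pi.smul_apply,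
    Pi.smul_apply, ← smul_add]
  exact congrArg _ (word_eq_add_of_isElementary hN hA hF hp a)

theorem exists_elementary (hN : Even N) (hA : A.IsMinimal) (hp : 2 ≤ p)
    {φ : MultilinearMap k (fun _ : Fin p => V) V} (hφ : IsHomogeneous 𝒜 𝒜 φ (1 - (p : ℤ))) :
    ∃ (B : Algebra 𝒜) (F : Hom A B), F.f = elementaryMaps φ ∧ (∀ l ≤ p, B.m l = A.m l) ∧
      evalSeq k V (p + 1) (B.m (p + 1)) = evalSeq k V (p + 1) (A.m (p + 1)) +
        ((-1 : k) ^ p) • hochschildDiff 𝒜 (A.m 2) p (1 - (p : ℤ)) φ := by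
  obtain ⟨B, F, hF⟩ := exists_transport hN A (elementaryMaps φ) (isHomogeneous_elementaryMaps hφ)
    (elementaryMaps_of_ne φ (by omega)) (elementaryMaps_of_ne φ (by omega))
  have elementary : IsElementary F.word p := by
    rw [word, hF]
    exact isElementary_barShift_elementaryMaps 𝒜 (by omega) φ
  refine ⟨B, F, hF, fun l => m_eq_of_isElementary hN hA elementary hp, ?_⟩
  rw [evalSeq_m_succ_of_isElementary hN hA elementary hp, hF, elementaryMaps_self]

end Elementary

theorem exists_remove_product (hN : Even N) {A : Algebra 𝒜} (hA : A.IsMinimal) {p : ℕ}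
    (hp : 2 ≤ p) (h : ∀ l, 3 ≤ l → l ≤ p → A.m l = 0)
    (hH : Subsingleton (HochschildCohomology 𝒜 (A.m 2) (p + 1) (2 - ((p + 1 : ℕ) : ℤ)))) :
    ∃ (B : Algebra 𝒜) (F : Hom A B), B.IsMinimal ∧ B.m 2 = A.m 2 ∧
      (∀ l, 3 ≤ l → l ≤ p + 1 → B.m l = 0) ∧ F.f 1 = idMaps k V 1 ∧
      ∀ l, 1 < l → l < p → F.f l = 0 := by
  obtain ⟨ψ, hψ, diff_ψ⟩ := exists_hochschildDiff_eq hH (A.homogeneous (p + 1) (by omega))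
    (hA.hochschildDiff_m_eq_zero hN (by omega) fun l hl hlp => h l hl (by omega))
  rw [show (2 : ℤ) - ((p + 1 : ℕ) : ℤ) = 1 - p by push_cast; ring] at hψ diff_ψ
  obtain ⟨B, F, hF, m_eq, m_succ⟩ := exists_elementary hN hA hp
    ((hochschildCochains 𝒜 p _).smul_mem ((-1 : k) ^ (p + 1)) hψ)
  refine ⟨B, F, (m_eq 1 (by omega)).trans hA, m_eq 2 hp, fun l hl hlp => ?_, ?_,
    fun l hl hlp => ?_⟩
  · rcases hlp.lt_or_eq with hlp | rfl
    · rw [m_eq l (by omega), h l hl (by omega)]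
    · refine evalSeq_injective (p + 1) ?_
      rw [m_succ, map_smul, diff_ψ, smul_smul, ← pow_add, Odd.neg_one_pow ⟨p, by ring⟩,
        neg_one_smul, add_neg_cancel, map_zero]
  · rw [hF, elementaryMaps_of_ne _ (by omega)]
  · rw [hF, elementaryMaps_of_ne _ hlp.ne, idMaps_of_ne_one hl.ne']

end Hom

end Obstruction

section Formality

variable {k : Type*} [Field k] {N : ℕ} {V W X : Type*} [AddCommGroup V] [Module k V]
  [AddCommGroup W] [Module k W] [AddCommGroup X] [Module k X]
  {𝒜 : ZMod N → Submodule k V} [DirectSum.Decomposition 𝒜]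

theorem insertSum_congr {f f' : ∀ n : ℕ, MultilinearMap k (fun _ : Fin n => V) W}
    {m m' : ∀ n : ℕ, MultilinearMap k (fun _ : Fin n => V) V} {n : ℕ}
    (hf : ∀ l ≤ n, f l = f' l) (hm : ∀ l ≤ n, m l = m' l) (a : ℕ → V) :
    insertSum 𝒜 f m n a = insertSum 𝒜 f' m' n a := by
  refine Finset.sum_congr rfl fun s hs => Finset.sum_congr rfl fun r _ => ?_
  rw [Finset.mem_Icc] at hs
  rw [hf (n - s + 1) (by omega), hm s hs.2]

theorem compSum_congr {g g' : ∀ n : ℕ, MultilinearMap k (fun _ : Fin n => W) X}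
    {f f' : ∀ n : ℕ, MultilinearMap k (fun _ : Fin n => V) W} {n : ℕ}
    (hg : ∀ l ≤ n, g l = g' l) (hf : ∀ l ≤ n, f l = f' l) (a : ℕ → V) :
    compSum 𝒜 g f n a = compSum 𝒜 g' f' n a := by
  refine Finset.sum_congr rfl fun c _ => ?_
  rw [hg _ c.length_le]
  simp only [hf _ (c.blocksFun_le _)]

theorem eq_of_le_of_stable {Y : ℕ → Type*} {u : ℕ → ∀ n, Y n}
    (hu : ∀ j, ∀ n ≤ j + 1, u (j + 1) n = u j n) {i j n : ℕ} (hij : i ≤ j) (hn : n ≤ i + 1) :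
    u j n = u i n := by
  induction j, hij using Nat.le_induction with
  | base => rfl
  | succ j hij ih => rw [hu j n (by omega), ih]

theorem eq_diagonal_of_stable {Y : ℕ → Type*} {u : ℕ → ∀ n, Y n}
    (hu : ∀ j, ∀ n ≤ j + 1, u (j + 1) n = u j n) {j n : ℕ} (hn : n ≤ j + 1) : u n n = u j n :=
  (le_total n j).elim (fun hnj => (eq_of_le_of_stable hu hnj n.le_succ).symm)
    fun hjn => eq_of_le_of_stable hu hjn hn

theorem Algebra.exists_limit {B : ℕ → Algebra 𝒜}
    (hB : ∀ j, ∀ n ≤ j + 1, (B (j + 1)).m n = (B j).m n) :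
    ∃ T : Algebra 𝒜, ∀ j, ∀ n ≤ j + 1, T.m n = (B j).m n := by
  have stable : ∀ j, ∀ n ≤ j + 1, (B n).m n = (B j).m n := fun _ _ =>
    eq_diagonal_of_stable (u := fun j => (B j).m) hB
  exact ⟨{
    m := fun n => (B n).m n
    m_zero := (B 0).m_zero
    homogeneous := fun n => (B n).homogeneous n
    relation := fun n hn a => by
      have diagonal : ∀ l ≤ n, (B l).m l = (B n).m l := fun l hl => stable n l (by omega)
      rw [insertSum_congr diagonal diagonal, (B n).relation n hn] }, stable⟩

theorem Algebra.IsMinimal.m_eq_zero {A : Algebra 𝒜} (hA : A.IsMinimal) {M : ℕ}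
    (h : ∀ l, 3 ≤ l → l ≤ M → A.m l = 0) {n : ℕ} (hn : n ≠ 2) (hnM : n ≤ M) : A.m n = 0 := by
  match n with
  | 0 => exact A.m_zero
  | 1 => exact hA
  | n + 3 => exact h _ (by omega) hnM

namespace Hom

variable {ℬ : ZMod N → Submodule k W} [DirectSum.Decomposition ℬ]

theorem exists_limit {A : Algebra 𝒜} {B : ℕ → Algebra ℬ} (F : ∀ j, Hom A (B j))
    (hF : ∀ j, ∀ n ≤ j + 1, (F (j + 1)).f n = (F j).f n) {T : Algebra ℬ}
    (hT : ∀ j, ∀ n ≤ j + 1, T.m n = (B j).m n) :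
    ∃ Φ : Hom A T, ∀ j, ∀ n ≤ j + 1, Φ.f n = (F j).f n := by
  have stable : ∀ j, ∀ n ≤ j + 1, (F n).f n = (F j).f n := fun _ _ =>
    eq_diagonal_of_stable (u := fun j => (F j).f) hF
  exact ⟨{
    f := fun n => (F n).f n
    f_zero := (F 0).f_zero
    homogeneous := fun n => (F n).homogeneous n
    relation := fun n hn a => by
      have diagonal : ∀ l ≤ n, (F l).f l = (F n).f l := fun l hl => stable n l (by omega)
      rw [compSum_congr (fun l hl => hT n l (by omega)) diagonal,
        insertSum_congr diagonal fun _ _ => rfl, (F n).relation n hn] }, stable⟩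

theorem comp_f_eq (hN : Even N) {A : Algebra 𝒜} {B C : Algebra ℬ} (G : Hom B C) (F : Hom A B)
    (hG : G.f 1 = idMaps k W 1) {j : ℕ} (h : ∀ l, 1 < l → l < j → G.f l = 0) {n : ℕ}
    (hn : n < j) : (comp hN G F).f n = F.f n := by
  refine multilinear_eq_of_barShift_eq 𝒜 fun w hw => ?_
  have unipotent : IsUnipotent k G.word := isUnipotent_barShift G.f_zero hG
  have word_eq_letter : ∀ v : List W, v.length ≤ w.length → G.word v = letter v := fun v hv => by
    match v with
    | [] => exact unipotent.map_nil
    | [x] => exact unipotent.map_singleton x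
    | x :: y :: v =>
      rw [letter_cons_cons]
      exact barShift_eq_zero ℬ (h _ (by simp) (by omega))
  calc barShift 𝒜 (comp hN G F).f w = pullback F.word G.word w := congrFun (word_ofWord ..) w
    _ = pullback F.word letter w := pullback_congr F.word word_eq_letter
    _ = barShift 𝒜 F.f w := pullback_letter (F.isBarMorphism_word hN).map_nil w

theorem isQuasiIso_of_isMinimal {A B : Algebra 𝒜} (hA : A.IsMinimal) (hB : B.IsMinimal)
    {F : Hom A B} (hF : F.f 1 = idMaps k V 1) : F.IsQuasiIso := by
  have linearPart_f : linearPart (F.f 1) = LinearMap.id := by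
    rw [hF]
    exact (MultilinearMap.ofSubsingleton k V V 0).symm_apply_apply _
  have d_eq_zero : ∀ {C : Algebra 𝒜}, C.IsMinimal → C.d = 0 := fun hC => by
    rw [Algebra.d, hC]
    rfl
  simp [IsQuasiIso, d_eq_zero hA, d_eq_zero hB, linearPart_f, sub_eq_zero]

end Hom

theorem exists_trivial_up_to (hN : Even N) {A : Algebra 𝒜} (hA : A.IsMinimal) (M : ℕ)
    (hH : ∀ n : ℕ, 3 ≤ n → n ≤ M →
      Subsingleton (HochschildCohomology 𝒜 (A.m 2) n (2 - (n : ℤ)))) :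
    ∃ (B : Algebra 𝒜) (F : Hom A B), B.IsMinimal ∧ B.m 2 = A.m 2 ∧
      (∀ l, 3 ≤ l → l ≤ M → B.m l = 0) ∧ F.f 1 = idMaps k V 1 := by
  induction M with
  | zero => exact ⟨A, Hom.id hN A, hA, rfl, fun l _ _ => by omega, by rw [Hom.id_f]⟩
  | succ M ih =>
    obtain ⟨B, F, hB, hB2, hBM, hF⟩ := ih fun n hn hn' => hH n hn (by omega)
    rcases lt_or_ge M 2 with hM | hM
    · exact ⟨B, F, hB, hB2, fun l _ _ => by omega, hF⟩
    · obtain ⟨C, G, hC, hC2, hCM, hG, _⟩ := Hom.exists_remove_product hN hB hM hBM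
        (hB2 ▸ hH (M + 1) (by omega) le_rfl)
      refine ⟨C, Hom.comp hN G F, hC, hC2.trans hB2, hCM, ?_⟩
      rw [Hom.comp_f_eq hN G F hG (j := 2) (fun l _ _ => by omega) one_lt_two, hF]

theorem exists_sequence (hN : Even N) {A : Algebra 𝒜} (hA : A.IsMinimal)
    (hH : ∀ n : ℕ, 3 ≤ n → Subsingleton (HochschildCohomology 𝒜 (A.m 2) n (2 - (n : ℤ)))) :
    ∃ (B : ℕ → Algebra 𝒜) (G : ∀ j : ℕ, Hom (B j) (B (j + 1))) (F : ∀ j : ℕ, Hom A (B j)),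
      B 0 = A ∧
      (∀ j, (B j).IsMinimal ∧ (B j).m 2 = A.m 2 ∧ ∀ l, 3 ≤ l → l ≤ j + 2 → (B j).m l = 0) ∧
      (∀ j, (G j).f 1 = idMaps k V 1 ∧ ∀ l, 1 < l → l < j + 2 → (G j).f l = 0) ∧
      (F 0).f = idMaps k V ∧ ∀ j, F (j + 1) = Hom.comp hN (G j) (F j) := by
  let P : ℕ → Algebra 𝒜 → Prop := fun j B =>
    B.IsMinimal ∧ B.m 2 = A.m 2 ∧ ∀ l, 3 ≤ l → l ≤ j + 2 → B.m l = 0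
  have base : P 0 A := ⟨hA, rfl, fun l hl hlj => by omega⟩
  have next : ∀ j (B : Algebra 𝒜), P j B → ∃ (C : Algebra 𝒜) (G : Hom B C), P (j + 1) C ∧
      G.f 1 = idMaps k V 1 ∧ ∀ l, 1 < l → l < j + 2 → G.f l = 0 := by
    rintro j B ⟨hB, hB2, hBj⟩
    obtain ⟨C, G, hC, hC2, hCj, hG⟩ := Hom.exists_remove_product hN hB (p := j + 2) (by omega) hBj
      (hB2 ▸ hH (j + 2 + 1) (by omega))
    exact ⟨C, G, ⟨hC, hC2.trans hB2, fun l hl hlj => hCj l hl (by omega)⟩, hG⟩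
  choose C G hC hG using next
  let B : ∀ j : ℕ, {B : Algebra 𝒜 // P j B} := fun j =>
    Nat.rec ⟨A, base⟩ (fun j B => ⟨C j B.1 B.2, hC j B.1 B.2⟩) j
  let F : ∀ j, Hom A (B j).1 := fun j =>
    Nat.rec (motive := fun j => Hom A (B j).1) (Hom.id hN A)
      (fun j Fj => Hom.comp hN (G j (B j).1 (B j).2) Fj) j
  exact ⟨fun j => (B j).1, fun j => G j (B j).1 (B j).2, F, rfl, fun j => (B j).2,
    fun j => hG j (B j).1 (B j).2, Hom.id_f hN A, fun _ => rfl⟩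

theorem exists_trivial_limit {A : Algebra 𝒜} {B : ℕ → Algebra 𝒜} (F : ∀ j, Hom A (B j))
    {μ : MultilinearMap k (fun _ : Fin 2 => V) V}
    (hB : ∀ j, (B j).IsMinimal ∧ (B j).m 2 = μ ∧ ∀ l, 3 ≤ l → l ≤ j + 2 → (B j).m l = 0)
    (hF : ∀ j, ∀ n ≤ j + 1, (F (j + 1)).f n = (F j).f n) :
    ∃ (T : Algebra 𝒜) (Φ : Hom A T), T.IsTrivial ∧ T.m 2 = μ ∧
      ∀ j, ∀ n ≤ j + 1, Φ.f n = (F j).f n := by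
  have m_eq_zero : ∀ j n, n ≠ 2 → n ≤ j + 2 → (B j).m n = 0 := fun j n =>
    (hB j).1.m_eq_zero (hB j).2.2
  have stable : ∀ j, ∀ n ≤ j + 1, (B (j + 1)).m n = (B j).m n := fun j n hn => by
    rcases eq_or_ne n 2 with rfl | hn2
    · rw [(hB _).2.1, (hB j).2.1]
    · rw [m_eq_zero _ n hn2 (by omega), m_eq_zero j n hn2 (by omega)]
  obtain ⟨T, hT⟩ := Algebra.exists_limit stable
  obtain ⟨Φ, hΦ⟩ := Hom.exists_limit F hF hT
  refine ⟨T, Φ, fun n hn => ?_, (hT 1 2 le_rfl).trans (hB 1).2.1, hΦ⟩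
  rw [hT n n n.le_succ, m_eq_zero n n hn (by omega)]

end Formality

end AInf


theorem mainTheorem3 {k : Type*} [Field k] {N : ℕ} (hN : Even N)
    {V : Type*} [AddCommGroup V] [Module k V]
    (𝒜 : ZMod N → Submodule k V) [DirectSum.Decomposition 𝒜]
    (A : AInf.Algebra 𝒜) (hA : A.IsMinimal) :
    -- removal of the first non-zero higher product
    (∀ n : ℕ, 3 ≤ n → (∀ l : ℕ, 3 ≤ l → l < n → A.m l = 0) →
      Subsingleton (AInf.HochschildCohomology 𝒜 (A.m 2) n (2 - (n : ℤ))) →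
      ∃ (B : AInf.Algebra 𝒜) (F : AInf.Hom A B),
        B.IsMinimal ∧ B.m 2 = A.m 2 ∧ (∀ l : ℕ, 3 ≤ l → l ≤ n → B.m l = 0) ∧
        F.f 1 = AInf.idMaps k V 1 ∧ (∀ l : ℕ, 1 < l → l < n - 1 → F.f l = 0) ∧ F.IsIso) ∧
    -- trivialisation up to a given order
    (∀ M : ℕ,
      (∀ n : ℕ, 3 ≤ n → n ≤ M →
        Subsingleton (AInf.HochschildCohomology 𝒜 (A.m 2) n (2 - (n : ℤ)))) →
      ∃ (B : AInf.Algebra 𝒜) (F : AInf.Hom A B),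
        B.IsMinimal ∧ B.m 2 = A.m 2 ∧ (∀ l : ℕ, 3 ≤ l → l ≤ M → B.m l = 0) ∧
        F.f 1 = AInf.idMaps k V 1 ∧ F.IsIso) ∧
    -- trivialisation to all orders, as the limit of the successive composites
    ((∀ n : ℕ, 3 ≤ n →
        Subsingleton (AInf.HochschildCohomology 𝒜 (A.m 2) n (2 - (n : ℤ)))) →
      (∃ (B : ℕ → AInf.Algebra 𝒜) (G : ∀ j : ℕ, AInf.Hom (B j) (B (j + 1)))
          (F : ∀ j : ℕ, AInf.Hom A (B j)) (T : AInf.Algebra 𝒜) (Φ : AInf.Hom A T),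
        B 0 = A ∧
        (∀ j : ℕ, (B j).IsMinimal ∧ (B j).m 2 = A.m 2 ∧
          ∀ l : ℕ, 3 ≤ l → l ≤ j + 2 → (B j).m l = 0) ∧
        (∀ j : ℕ, (G j).IsIso ∧ (G j).f 1 = AInf.idMaps k V 1 ∧
          ∀ l : ℕ, 1 < l → l < j + 2 → (G j).f l = 0) ∧
        (F 0).f = AInf.idMaps k V ∧
        (∀ j : ℕ, (G j).IsComp (F j) (F (j + 1))) ∧
        T.IsTrivial ∧ T.m 2 = A.m 2 ∧
        (∀ n j : ℕ, n ≤ j + 1 → (F j).f n = Φ.f n) ∧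
        Φ.f 1 = AInf.idMaps k V 1 ∧ Φ.IsIso) ∧
      A.IsFormal) := by
  refine ⟨fun n hn hm hH => ?_, fun M hH => ?_, fun hH => ?_⟩
  · obtain ⟨p, rfl⟩ : ∃ p, n = p + 1 := ⟨n - 1, by omega⟩
    obtain ⟨B, F, hB, hB2, hBn, hF, hFl⟩ := AInf.Hom.exists_remove_product hN hA (by omega)
      (fun l hl hlp => hm l hl (by omega)) hH
    exact ⟨B, F, hB, hB2, hBn, hF, hFl, F.isIso_of_f_one hN hF⟩
  · obtain ⟨B, F, hB, hB2, hBM, hF⟩ := AInf.exists_trivial_up_to hN hA M hH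
    exact ⟨B, F, hB, hB2, hBM, hF, F.isIso_of_f_one hN hF⟩
  · obtain ⟨B, G, F, hB0, hB, hG, hF0, hF⟩ := AInf.exists_sequence hN hA hH
    have stable : ∀ j, ∀ n ≤ j + 1, (F (j + 1)).f n = (F j).f n := fun j n hn => by
      rw [hF]
      exact AInf.Hom.comp_f_eq hN (G j) (F j) (hG j).1 (hG j).2 (by omega)
    obtain ⟨T, Φ, hT, hT2, hΦ⟩ := AInf.exists_trivial_limit F hB stable
    have hΦ1 : Φ.f 1 = AInf.idMaps k V 1 := by rw [hΦ 0 1 le_rfl, hF0]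
    refine ⟨⟨B, G, F, T, Φ, hB0, hB, fun j => ⟨(G j).isIso_of_f_one hN (hG j).1, hG j⟩, hF0,
      fun j => ?_, hT, hT2, fun n j hn => (hΦ j n hn).symm, hΦ1, Φ.isIso_of_f_one hN hΦ1⟩,
      V, _, _, 𝒜, _, T, Φ, hT, AInf.Hom.isQuasiIso_of_isMinimal hA (hT 1 (by omega)) hΦ1⟩
    rw [hF]
    exact AInf.Hom.isComp_comp hN (G j) (F j)
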